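/- Let $n\ge 2$ and let the braid group $B_{n+1}$ on $n+1$ strands, with standard generators $\sigma_1,\dots,\sigma_n$, act on $\mathbb{Z}^n$ (vectors $(k_1,\dots,k_n)$) through the linear representation $\rho$ given by $$\sigma_1:\ k_1\mapsto k_1,\quad k_j\mapsto k_j+k_1\ (j>1),\qquad \sigma_i:\ k_{i-1}\mapsto 2k_{i-1}-k_i,\quad k_i\mapsto k_{i-1},\quad k_j\mapsto k_j\ (j\ne i-1,i)\qquad(i>1),$$ and let ${\cal G}_n=\rho(B_{n+1})$. Put $x_i=k_i-k_{i-1}+\dots+(-1)^{i+1}k_1$ for $1\le i\le n$, $x_{n+1}=0$, and $p_i=x_{2i}$, $q_i=x_{2i-1}-x_{2i+1}$ for $1\le i\le s$, where $s=\lfloor n/2\rfloor\ge 1$. Write the elements of ${\cal G}_n$ as matrices in the coordinates $(q_1,\dots,q_s,p_1,\dots,p_s)$ if $n=2s$, and in the coordinates $(q_1,\dots,q_s,p_1,\dots,p_s,x_{2s+1})$ if $n=2s+1$. (a) Let $n=2s$. Then ${\cal G}_{2s}\subset Sp(2s,\mathbb{Z})$, the symplectic group of the form $\sum_i(q_ip_i'-p_iq_i')$.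 The reduction of ${\cal G}_{2s}$ modulo 2 is isomorphic to the symmetric group $S_{2s+1}$ of $\{0,1,\dots,2s\}$, by an isomorphism taking the reduction of $\rho(\sigma_i)$ to the transposition $(i-1,i)$ for every $i$. Moreover ${\cal G}_{2s}$ contains the principal congruence subgroup of level 2, $\ker(Sp(2s,\mathbb{Z})\to Sp(2s,\mathbb{Z}/2\mathbb{Z}))$, and $$[Sp(2s,\mathbb{Z}):{\cal G}_{2s}]=\frac{2^{s^2}\prod_{k=1}^s(2^{2k}-1)}{(2s+1)!}.$$ (b) Let $n=2s+1$. Then ${\cal G}_{2s+1}\subset Sp(2s,\mathbb{Z})\ltimes\mathbb{Z}^{2s}$, realized as the group of block matrices $\begin{pmatrix}g_0&g_1\\0&1\end{pmatrix}$ with $g_0\in Sp(2s,\mathbb{Z})$ and $g_1\in\mathbb{Z}^{2s}$. The reduction of ${\cal G}_{2s+1}$ modulo 2 is isomorphic to the symmetric group $S_{2s+2}$ of $\{0,1,\dots,2s+1\}$, by an isomorphism taking the reduction of $\rho(\sigma_i)$ to the transposition $(i-1,i)$ for every $i$. Moreover ${\cal G}_{2s+1}$ contains the principal congruence subgroup of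 level 2, $\ker\bigl(Sp(2s,\mathbb{Z})\ltimes\mathbb{Z}^{2s}\to Sp(2s,\mathbb{Z}/2\mathbb{Z})\ltimes(\mathbb{Z}/2\mathbb{Z})^{2s}\bigr)$, and $$[Sp(2s,\mathbb{Z})\ltimes\mathbb{Z}^{2s}:{\cal G}_{2s+1}]=\frac{2^{s^2+2s}\prod_{k=1}^s(2^{2k}-1)}{(2s+2)!}.$$ -/

import Mathlib

open Matrix

namespace BraidSymplectic

/-! ### The braid group and its linear representation -/

/-- The defining relations of the braid group on `n + 1` strands, for generators
`σ_1, …, σ_n`; the generator `σ_{i+1}` is indexed by `i : Fin n`. -/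
inductive BraidRel (n : ℕ) : FreeGroup (Fin n) → Prop
  | braid (i j : Fin n) (h : (i : ℕ) + 1 = j) :
      BraidRel n (FreeGroup.of i * FreeGroup.of j * FreeGroup.of i *
        (FreeGroup.of j * FreeGroup.of i * FreeGroup.of j)⁻¹)
  | comm (i j : Fin n) (h : (i : ℕ) + 1 < j) :
      BraidRel n (FreeGroup.of i * FreeGroup.of j * (FreeGroup.of j * FreeGroup.of i)⁻¹)

/-- `BraidGroup n` is the Artin braid group `B_{n+1}` on `n + 1` strands. -/
abbrev BraidGroup (n : ℕ) : Type := PresentedGroup {r | BraidRel n r}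

/-- The action of the generator `σ_{i+1}` on the vector `(k_1, …, k_n)`, whose entry `k_{j+1}`
is `k j`:
`σ_1 : k_1 ↦ k_1, k_j ↦ k_j + k_1` for `j > 1`, and for `i > 1`
`σ_i : k_{i-1} ↦ 2 k_{i-1} - k_i, k_i ↦ k_{i-1}`, the other entries being fixed. -/
def sigmaFun {n : ℕ} (i : Fin n) (k : Fin n → ℤ) : Fin n → ℤ := fun j =>
  if (i : ℕ) = 0 then (if j = i then k i else k j + k i)
  else if j = i then k ⟨i - 1, by omega⟩
  else if (j : ℕ) + 1 = i then 2 * k j - k i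
  else k j

/-- The inverse of `sigmaFun i`. -/
def sigmaInvFun {n : ℕ} (i : Fin n) (k : Fin n → ℤ) : Fin n → ℤ := fun j =>
  if (i : ℕ) = 0 then (if j = i then k i else k j - k i)
  else if j = i then 2 * k i - k ⟨i - 1, by omega⟩
  else if (j : ℕ) + 1 = i then k i
  else k j

/-- The linear automorphism of `ℤ^n` by which `σ_{i+1}` acts. -/
def sigma {n : ℕ} (i : Fin n) : (Fin n → ℤ) ≃ₗ[ℤ] (Fin n → ℤ) where
  toFun := sigmaFun i
  invFun := sigmaInvFun i
  map_add' k l := by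
    funext j
    simp only [sigmaFun, Pi.add_apply]
    split_ifs <;> ring
  map_smul' c k := by
    funext j
    simp only [sigmaFun, Pi.smul_apply, smul_eq_mul, RingHom.id_apply]
    split_ifs <;> ring
  left_inv k := by
    funext j
    simp only [sigmaFun, sigmaInvFun]
    grind
  right_inv k := by
    funext j
    simp only [sigmaFun, sigmaInvFun]
    grind

theorem sigma_apply {n : ℕ} (i : Fin n) (k : Fin n → ℤ) (j : Fin n) :
    sigma i k j = sigmaFun i k j := rfl

theorem sigma_braid {n : ℕ} (i j : Fin n) (h : (i : ℕ) + 1 = j) :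
    sigma i * sigma j * sigma i = sigma j * sigma i * sigma j := by
  apply LinearEquiv.ext
  intro k
  funext l
  simp only [LinearEquiv.mul_apply, sigma_apply]
  simp only [sigmaFun, sigma_apply]
  grind

theorem sigma_comm {n : ℕ} (i j : Fin n) (h : (i : ℕ) + 1 < j) :
    sigma i * sigma j = sigma j * sigma i := by
  apply LinearEquiv.ext
  intro k
  funext l
  simp only [LinearEquiv.mul_apply, sigma_apply]
  simp only [sigmaFun, sigma_apply]
  grind

/-- The representation `ρ : B_{n+1} → GL(ℤ^n)`. -/
def rho (n : ℕ) : BraidGroup n →* ((Fin n → ℤ) ≃ₗ[ℤ] (Fin n → ℤ)) :=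
  PresentedGroup.toGroup (f := sigma) (by
    rintro r (⟨i, j, h⟩ | ⟨i, j, h⟩)
    · simp only [map_mul, map_inv, FreeGroup.lift_apply_of]
      exact mul_inv_eq_one.mpr (sigma_braid i j h)
    · simp only [map_mul, map_inv, FreeGroup.lift_apply_of]
      exact mul_inv_eq_one.mpr (sigma_comm i j h))

/-- The matrices of the representation `ρ` (acting on column vectors) in the linear coordinates
`c` on `ℤ^n`. -/
def rhoMatrix {n : ℕ} {ι : Type} [Fintype ι] [DecidableEq ι]
    (c : (Fin n → ℤ) ≃ₗ[ℤ] (ι → ℤ)) : BraidGroup n →* GL ι ℤ :=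
  ((Matrix.GeneralLinearGroup.toLin (n := ι) (R := ℤ)).symm.toMonoidHom.comp
    (LinearMap.GeneralLinearGroup.congrLinearEquiv c).toMonoidHom).comp
    ((LinearMap.GeneralLinearGroup.generalLinearEquiv ℤ (Fin n → ℤ)).symm.toMonoidHom.comp
      (rho n))

/-! ### The coordinates `x`, and the canonical coordinates `q`, `p` -/

/-- A finite vector, extended by zero. -/
def ext0 {n : ℕ} (k : Fin n → ℤ) (j : ℕ) : ℤ := if h : j < n then k ⟨j, h⟩ else 0

theorem ext0_add {n : ℕ} (k l : Fin n → ℤ) (j : ℕ) :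
    ext0 (k + l) j = ext0 k j + ext0 l j := by
  unfold ext0; split_ifs <;> simp

theorem ext0_smul {n : ℕ} (c : ℤ) (k : Fin n → ℤ) (j : ℕ) :
    ext0 (c • k) j = c * ext0 k j := by
  unfold ext0; split_ifs <;> simp

theorem ext0_val {n : ℕ} (k : Fin n → ℤ) (j : Fin n) : ext0 k j = k j := by
  simp [ext0]

/-- The alternating sum `f_i - f_{i-1} + ⋯ ± f_0`. -/
def altSum (f : ℕ → ℤ) (i : ℕ) : ℤ := ∑ j ∈ Finset.range (i + 1), (-1) ^ (i - j) * f j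

theorem altSum_zero (f : ℕ → ℤ) : altSum f 0 = f 0 := by simp [altSum]

theorem altSum_succ (f : ℕ → ℤ) (i : ℕ) : altSum f (i + 1) = f (i + 1) - altSum f i := by
  unfold altSum
  rw [Finset.sum_range_succ, sub_eq_add_neg, ← Finset.sum_neg_distrib, add_comm]
  congr 1
  · simp
  · refine Finset.sum_congr rfl fun j hj => ?_
    have : i + 1 - j = (i - j) + 1 := by have := Finset.mem_range.mp hj; omega
    rw [this, pow_succ]; ring

/-- The coordinates `x_i = k_i - k_{i-1} + ⋯ + (-1)^{i+1} k_1`, with inverse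
`k_i = x_{i-1} + x_i` (and `x_0 = 0`). -/
def xCoords (n : ℕ) : (Fin n → ℤ) ≃ₗ[ℤ] (Fin n → ℤ) where
  toFun k := fun i => altSum (ext0 k) i
  invFun x := fun i => (if (i : ℕ) = 0 then 0 else ext0 x (i - 1)) + x i
  map_add' k l := by
    funext i
    simp only [altSum, ext0_add, Pi.add_apply, ← Finset.sum_add_distrib, mul_add]
  map_smul' c k := by
    funext i
    simp only [altSum, ext0_smul, Pi.smul_apply, smul_eq_mul, RingHom.id_apply, Finset.mul_sum]
    exact Finset.sum_congr rfl fun j _ => by ring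
  left_inv k := by
    funext ⟨i, hi⟩
    rcases i with _ | i
    · simp [altSum_zero, ext0, hi]
    · have h : i < n := by omega
      simp [altSum_succ, ext0, hi, h]
  right_inv x := by
    funext ⟨i, hi⟩
    induction i with
    | zero => simp [altSum_zero, ext0, hi]
    | succ i ih =>
      have h : i < n := by omega
      have := ih h
      simp only at this
      simp only [altSum_succ, this]
      simp [ext0, hi, h]

theorem sum_Ico_sub' (X : ℕ → ℤ) (i s : ℕ) (h : i ≤ s) :
    ∑ j ∈ Finset.Ico i s, (X (2 * j) - X (2 * j + 2)) = X (2 * i) - X (2 * s) := by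
  induction s, h using Nat.le_induction with
  | base => simp
  | succ s hs ih => rw [Finset.sum_Ico_succ_top hs, ih, Nat.mul_succ]; ring

/-- For `n = 2s`: the coordinates `q_i = x_{2i-1} - x_{2i+1}` (where `x_{2s+1} = 0`) and
`p_i = x_{2i}`, `1 ≤ i ≤ s`, with inverse `x_{2i-1} = ∑_{j ≥ i} q_j`, `x_{2i} = p_i`.
The coordinates `q` come first, then the coordinates `p`. -/
def qpEven (s : ℕ) : (Fin (2 * s) → ℤ) ≃ₗ[ℤ] (Fin s ⊕ Fin s → ℤ) where
  toFun x := Sum.elim (fun i => ext0 x (2 * i) - ext0 x (2 * i + 2))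
    (fun i => ext0 x (2 * i + 1))
  invFun v := fun a =>
    if (a : ℕ) % 2 = 0 then ∑ j ∈ Finset.Ico ((a : ℕ) / 2) s, ext0 (fun i => v (Sum.inl i)) j
    else ext0 (fun i => v (Sum.inr i)) ((a : ℕ) / 2)
  map_add' x y := by
    funext i
    rcases i with i | i <;> simp only [Sum.elim_inl, Sum.elim_inr, Pi.add_apply, ext0_add]
    ring
  map_smul' c x := by
    funext i
    rcases i with i | i <;>
      simp only [Sum.elim_inl, Sum.elim_inr, Pi.smul_apply, ext0_smul, smul_eq_mul,
        RingHom.id_apply]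
    ring
  left_inv x := by
    funext ⟨a, ha⟩
    simp only [Sum.elim_inl, Sum.elim_inr]
    split_ifs with h
    · rw [Finset.sum_congr rfl (g := fun j => ext0 x (2 * j) - ext0 x (2 * j + 2)),
        sum_Ico_sub' _ _ _ (by omega)]
      · have h2 : 2 * (a / 2) = a := by omega
        simp [ext0, h2, ha]
      · intro j hj
        simp [ext0, (Finset.mem_Ico.mp hj).2]
    · have h2 : 2 * (a / 2) + 1 = a := by omega
      have h3 : a / 2 < s := by omega
      simp [ext0, h2, h3, ha]
  right_inv v := by
    funext i
    rcases i with ⟨i, hi⟩ | ⟨i, hi⟩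
    · simp only [Sum.elim_inl]
      rcases Nat.lt_or_ge (i + 1) s with h | h
      · have h1 : 2 * i < 2 * s := by omega
        have h2 : 2 * i + 2 < 2 * s := by omega
        have h3 : (2 * i + 2) / 2 = i + 1 := by omega
        simp [ext0, h1, h2, h3, Finset.sum_eq_sum_Ico_succ_bot hi, hi]
      · have h1 : 2 * i < 2 * s := by omega
        have h2 : ¬ 2 * i + 2 < 2 * s := by omega
        have h3 : Finset.Ico (i + 1) s = ∅ := Finset.Ico_eq_empty (by omega)
        simp [ext0, h1, h2, Finset.sum_eq_sum_Ico_succ_bot hi, hi, h3]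
    · have h1 : 2 * i + 1 < 2 * s := by omega
      have h2 : (2 * i + 1) / 2 = i := by omega
      have h3 : (2 * i + 1) % 2 ≠ 0 := by omega
      simp [ext0, h1, h2, h3, hi]

/-- For `n = 2s + 1`: the coordinates `q_i = x_{2i-1} - x_{2i+1}` and `p_i = x_{2i}`,
`1 ≤ i ≤ s`, followed by the last coordinate `x_{2s+1}`. -/
def qpOdd (s : ℕ) : (Fin (2 * s + 1) → ℤ) ≃ₗ[ℤ] ((Fin s ⊕ Fin s) ⊕ Unit → ℤ) where
  toFun x := Sum.elim (Sum.elim (fun i => ext0 x (2 * i) - ext0 x (2 * i + 2))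
    (fun i => ext0 x (2 * i + 1))) (fun _ => ext0 x (2 * s))
  invFun v := fun a =>
    if (a : ℕ) % 2 = 0 then
      ∑ j ∈ Finset.Ico ((a : ℕ) / 2) s, ext0 (fun i => v (Sum.inl (Sum.inl i))) j
        + v (Sum.inr ())
    else ext0 (fun i => v (Sum.inl (Sum.inr i))) ((a : ℕ) / 2)
  map_add' x y := by
    funext i
    rcases i with (i | i) | i <;> simp only [Sum.elim_inl, Sum.elim_inr, Pi.add_apply, ext0_add]
    ring
  map_smul' c x := by
    funext i
    rcases i with (i | i) | i <;>
      simp only [Sum.elim_inl, Sum.elim_inr, Pi.smul_apply, ext0_smul, smul_eq_mul,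
        RingHom.id_apply]
    ring
  left_inv x := by
    funext ⟨a, ha⟩
    simp only [Sum.elim_inl, Sum.elim_inr]
    split_ifs with h
    · rw [Finset.sum_congr rfl (g := fun j => ext0 x (2 * j) - ext0 x (2 * j + 2)),
        sum_Ico_sub' _ _ _ (by omega)]
      · have h2 : 2 * (a / 2) = a := by omega
        simp [ext0, h2, ha]
      · intro j hj
        simp [ext0, (Finset.mem_Ico.mp hj).2]
    · have h2 : 2 * (a / 2) + 1 = a := by omega
      have h3 : a / 2 < s := by omega
      simp [ext0, h2, h3, ha]
  right_inv v := by
    funext i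
    rcases i with (⟨i, hi⟩ | ⟨i, hi⟩) | i
    · simp only [Sum.elim_inl]
      have h1 : 2 * i < 2 * s + 1 := by omega
      have h2 : 2 * i + 2 < 2 * s + 1 := by omega
      have h3 : (2 * i + 2) / 2 = i + 1 := by omega
      simp [ext0, h1, h2, h3, Finset.sum_eq_sum_Ico_succ_bot hi, hi]
    · have h1 : 2 * i + 1 < 2 * s + 1 := by omega
      have h2 : (2 * i + 1) / 2 = i := by omega
      have h3 : (2 * i + 1) % 2 ≠ 0 := by omega
      simp [ext0, h1, h2, h3, hi]
    · simp [ext0]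

/-- `ρ` on `B_{2s+1}` as integer matrices in the canonical coordinates `q_1, …, q_s, p_1, …, p_s`. -/
def rhoEven (s : ℕ) : BraidGroup (2 * s) →* GL (Fin s ⊕ Fin s) ℤ :=
  rhoMatrix ((xCoords (2 * s)).trans (qpEven s))

/-- `ρ` on `B_{2s+2}` as integer matrices in the coordinates
`q_1, …, q_s, p_1, …, p_s, x_{2s+1}`. -/
def rhoOdd (s : ℕ) : BraidGroup (2 * s + 1) →* GL ((Fin s ⊕ Fin s) ⊕ Unit) ℤ :=
  rhoMatrix ((xCoords (2 * s + 1)).trans (qpOdd s))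

/-! ### The ambient groups and reduction modulo 2 -/

/-- The symplectic group `Sp(2s, ℤ)`, as a group of invertible matrices. -/
def Sp (s : ℕ) : Subgroup (GL (Fin s ⊕ Fin s) ℤ) where
  carrier := {g | (g : Matrix (Fin s ⊕ Fin s) (Fin s ⊕ Fin s) ℤ) ∈ symplecticGroup (Fin s) ℤ}
  mul_mem' {a b} ha hb := by
    simpa using mul_mem ha hb
  one_mem' := by simp
  inv_mem' {a} ha := by
    have h : ((⟨_, ha⟩ : symplecticGroup (Fin s) ℤ)⁻¹ : symplecticGroup (Fin s) ℤ).1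
        = (a : Matrix (Fin s ⊕ Fin s) (Fin s ⊕ Fin s) ℤ)⁻¹ := SymplecticGroup.coe_inv' _
    simp only [Set.mem_ofPred_eq, Matrix.coe_units_inv, ← h]
    exact Subtype.prop _

/-- The semidirect product `Sp(2s, ℤ) ⋉ ℤ^{2s}`: the block matrices `(g₀ g₁; 0 1)` with
`g₀ ∈ Sp(2s, ℤ)` and an arbitrary column `g₁ ∈ ℤ^{2s}`. -/
def SpAffine (s : ℕ) : Subgroup (GL ((Fin s ⊕ Fin s) ⊕ Unit) ℤ) where
  carrier := {g | ∃ g₀ ∈ Sp s, ∃ g₁ : Fin s ⊕ Fin s → ℤ,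
    (g : Matrix ((Fin s ⊕ Fin s) ⊕ Unit) ((Fin s ⊕ Fin s) ⊕ Unit) ℤ) =
      fromBlocks (g₀ : Matrix (Fin s ⊕ Fin s) (Fin s ⊕ Fin s) ℤ) (replicateCol Unit g₁) 0 1}
  mul_mem' := by
    rintro a b ⟨a₀, ha, a₁, ea⟩ ⟨b₀, hb, b₁, eb⟩
    refine ⟨a₀ * b₀, mul_mem ha hb,
      (a₀ : Matrix (Fin s ⊕ Fin s) (Fin s ⊕ Fin s) ℤ) *ᵥ b₁ + a₁, ?_⟩
    rw [Units.val_mul, ea, eb, fromBlocks_multiply]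
    simp [replicateCol_add, replicateCol_mulVec]
  one_mem' := ⟨1, one_mem _, 0, by simp [fromBlocks_one]⟩
  inv_mem' := by
    rintro a ⟨a₀, ha, a₁, ea⟩
    refine ⟨a₀⁻¹, inv_mem ha,
      -(((a₀⁻¹ : GL (Fin s ⊕ Fin s) ℤ) : Matrix (Fin s ⊕ Fin s) (Fin s ⊕ Fin s) ℤ) *ᵥ a₁), ?_⟩
    refine Units.inv_eq_of_mul_eq_one_right ?_
    rw [ea, fromBlocks_multiply, ← fromBlocks_one]
    have h : (a₀ : Matrix (Fin s ⊕ Fin s) (Fin s ⊕ Fin s) ℤ) *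
        ((a₀⁻¹ : GL (Fin s ⊕ Fin s) ℤ) : Matrix (Fin s ⊕ Fin s) (Fin s ⊕ Fin s) ℤ) = 1 :=
      Units.mul_inv a₀
    have h2 : replicateCol Unit (-(((a₀⁻¹ : GL (Fin s ⊕ Fin s) ℤ) :
          Matrix (Fin s ⊕ Fin s) (Fin s ⊕ Fin s) ℤ) *ᵥ a₁))
        = -(((a₀⁻¹ : GL (Fin s ⊕ Fin s) ℤ) :
          Matrix (Fin s ⊕ Fin s) (Fin s ⊕ Fin s) ℤ) * replicateCol Unit a₁) := by
      rw [← replicateCol_mulVec]; rfl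
    rw [h2, Matrix.mul_neg, ← Matrix.mul_assoc, h]
    simp

/-- Entrywise reduction modulo 2 of invertible integer matrices. -/
def mod2 (ι : Type) [Fintype ι] [DecidableEq ι] : GL ι ℤ →* GL ι (ZMod 2) :=
  Matrix.GeneralLinearGroup.map (Int.castRingHom (ZMod 2))

/-- The principal congruence subgroup of level 2 of a group of integer matrices: the kernel of
the reduction modulo 2 on this group. -/
def principalCongruence {ι : Type} [Fintype ι] [DecidableEq ι] (H : Subgroup (GL ι ℤ)) :
    Subgroup (GL ι ℤ) :=
  H ⊓ (mod2 ι).ker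

end BraidSymplectic

/-! Every generator acts as a symplectic transvection x ↦ x + ω(x, a) a. For n = 2s the vectors a_0,
…, a_{2s-1} form a chain: neighbours pair to 1, all other pairs are orthogonal (`isChain_chainVec`,
`qpFun_eq`, `glEquiv_rhoEven_of`). So the image is symplectic, and the rest is group theory of
transvections along a chain.

Level 2. Conjugating one transvection by another moves its direction, and the full twist relation
`transv_sq_add_eq` yields squares along further sums. Thus the image contains the squares along the
members, and along suitable sums and differences, of the hyperbolic basis E_i = a_0 + a_2 + ⋯ +
a_{2i}, F_i = a_{2i+1} (`IsChain.isRich`). These squares generate the level 2 group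
(`IsRich.exists_eqOn`) by a Euclidean algorithm with even multipliers. Such an algorithm could stall
at |remainder| = |divisor|, but a column congruent to a basis vector modulo 2 has one odd coordinate
and all others even, so dividing an even coordinate by the odd one leaves a strictly smaller
remainder.

Reduction modulo 2. Writing k_j ≡ w_j + w_0, the generators merely permute the entries of w. Hence,
as soon as there are three strands, a braid acts trivially modulo 2 exactly when its permutation is
trivial (`mod2_rhoMatrix_eq_one_iff_braidPerm`).

Odd n. The coordinate x_{2s+1} is invariant, so the action is affine on ℤ^{2s}. The first 2s
generators share a fixed vector P and act as in the even case, while the last is a transvection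
centred at the origin. Comparing two affine maps with equal linear part and different centres gives
a translation, which spreads to all of 2ℤ^{2s} (`two_smul_mem_translations`). A level 2 element is
then corrected by a translation to fix P, which reduces it to the even case.

Index. Since the image contains the level 2 group, its index can be read off modulo 2: the order of
the reduced ambient group, found by counting orbits (`IsHyperbolic.card_eq_prod`), over (n + 1)!. -/

namespace BraidSymplectic

set_option linter.unusedSimpArgs false
set_option linter.unusedSectionVars false

/-! ### Symplectic transvections -/

section Transvection

variable {R M : Type*} [CommRing R] [AddCommGroup M] [Module R M]

/-- The transvection `x ↦ x + c ω(x, v) v` of an alternating form `ω`. -/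
def transv (ω : LinearMap.BilinForm R M) (hω : ω.IsAlt) (v : M) (c : R) : M ≃ₗ[R] M where
  toFun x := x + (c * ω x v) • v
  invFun x := x - (c * ω x v) • v
  map_add' x y := by simp only [map_add, LinearMap.add_apply]; module
  map_smul' r x := by simp only [map_smul, LinearMap.smul_apply, smul_eq_mul, RingHom.id_apply]; module
  left_inv x := by simp [hω v]
  right_inv x := by simp [hω v]

/-- The group of linear isometries of a bilinear form. -/
def isometries (ω : LinearMap.BilinForm R M) : Subgroup (M ≃ₗ[R] M) where
  carrier := {g | ∀ x y, ω (g x) (g y) = ω x y}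
  mul_mem' {g h} hg hh x y := by simp [LinearEquiv.mul_apply, hg _ _, hh _ _]
  one_mem' x y := rfl
  inv_mem' {g} hg x y := by
    rw [← hg (g⁻¹ x) (g⁻¹ y)]
    simp

variable {ω : LinearMap.BilinForm R M} (hω : ω.IsAlt)

theorem alt_swap {ω : LinearMap.BilinForm R M} (hω : ω.IsAlt) (x y : M) : ω y x = -ω x y :=
  (LinearMap.IsAlt.neg hω x y).symm

theorem mem_isometries {g : M ≃ₗ[R] M} : g ∈ isometries ω ↔ ∀ x y, ω (g x) (g y) = ω x y := Iff.rfl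

theorem transv_apply (v : M) (c : R) (x : M) : transv ω hω v c x = x + (c * ω x v) • v := rfl

theorem transv_zero (v : M) : transv ω hω v 0 = 1 := by
  ext x; simp [transv_apply]

theorem transv_mul (v : M) (c d : R) :
    transv ω hω v c * transv ω hω v d = transv ω hω v (c + d) := by
  ext x
  simp only [LinearEquiv.mul_apply, transv_apply, map_add, map_smul, LinearMap.add_apply,
    LinearMap.smul_apply, hω v, smul_eq_mul]
  module

theorem transv_inv (v : M) (c : R) : (transv ω hω v c)⁻¹ = transv ω hω v (-c) := by
  rw [inv_eq_iff_mul_eq_one, transv_mul, add_neg_cancel, transv_zero]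

theorem transv_neg (v : M) (c : R) : transv ω hω (-v) c = transv ω hω v c := by
  ext x; simp [transv_apply]

theorem transv_conj {g : M ≃ₗ[R] M} (hg : g ∈ isometries ω) (v : M) (c : R) :
    g * transv ω hω v c * g⁻¹ = transv ω hω (g v) c := by
  rw [mul_inv_eq_iff_eq_mul]
  ext x
  simp [LinearEquiv.mul_apply, transv_apply, hg x v]

theorem transv_mem_isometries (v : M) (c : R) : transv ω hω v c ∈ isometries ω := by
  intro x y
  have h := alt_swap hω y v
  simp only [transv_apply, map_add, map_smul, LinearMap.add_apply, LinearMap.smul_apply, hω v,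
    smul_eq_mul, h]
  ring

variable {H : Subgroup (M ≃ₗ[R] M)}

/-- Conjugating by the transvection along `r` replaces the direction `v` by its image and keeps the
multiplier `c`. -/
theorem transv_apply_mem {v r : M} {c : R} (hv : transv ω hω v c ∈ H) (d : R)
    (hr : transv ω hω r d ∈ H) : transv ω hω (v + (d * ω v r) • r) c ∈ H := by
  have := transv_conj hω (transv_mem_isometries hω r d) v c
  rw [transv_apply] at this
  rw [← this]
  exact mul_mem (mul_mem hr hv) (inv_mem hr)

theorem transv_add_mem {v r : M} {c : R} (hv : transv ω hω v c ∈ H)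
    (hr : transv ω hω r 1 ∈ H) (h : ω v r = 1) : transv ω hω (v + r) c ∈ H := by
  simpa [h] using transv_apply_mem hω hv 1 hr

theorem transv_sq_mem {v : M} (hv : transv ω hω v 1 ∈ H) : transv ω hω v 2 ∈ H := by
  have := mul_mem hv hv
  rwa [transv_mul, one_add_one_eq_two] at this

theorem transv_two_mul_mem {v : M} (hv : transv ω hω v 2 ∈ H) (k : ℤ) :
    transv ω hω v (2 * k) ∈ H := by
  have key : ∀ k : ℕ, transv ω hω v (2 * k) ∈ H := fun k => by
    induction k with
    | zero => simp [transv_zero, one_mem]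
    | succ k ih =>
      have := mul_mem ih hv
      rwa [transv_mul, ← mul_add_one, ← Nat.cast_succ] at this
  obtain ⟨k, rfl | rfl⟩ := k.eq_nat_or_neg
  · simpa using key k
  · have := inv_mem (key k)
    rw [transv_inv] at this
    simpa using this

/-- The square of the transvection along `x + z` is a product of squares of transvections: this is
the decomposition of the full twist on four strands. -/
theorem transv_sq_add_eq {x y z : M} (hxy : ω x y = 1) (hyz : ω y z = 1) (hxz : ω x z = 0) :
    transv ω hω x 2 * transv ω hω (x + y) 2 * transv ω hω y 2 * transv ω hω (x + y + z) 2 *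
      transv ω hω (y + z) 2 * transv ω hω z 2 = transv ω hω (x + z) 2 := by
  have hyx : ω y x = -1 := by rw [alt_swap hω x y, hxy]
  have hzy : ω z y = -1 := by rw [alt_swap hω y z, hyz]
  have hzx : ω z x = 0 := by rw [alt_swap hω x z, hxz, neg_zero]
  ext v
  simp only [LinearEquiv.mul_apply, transv_apply, map_add, map_smul, LinearMap.add_apply,
    LinearMap.smul_apply, hω x, hω y, hω z, hxy, hyz, hxz, hyx, hzy, hzx, smul_eq_mul]
  module

/-- In the full twist relation the factors along `x + y` and `x + y + z` are conjugates of the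
square along `x`; the others come from the transvections along `y` and `z`. Only the square along
`x` is needed, so the lemma can be iterated with `x` a growing partial sum. -/
theorem transv_sq_add_mem {x y z : M} (hxy : ω x y = 1) (hyz : ω y z = 1) (hxz : ω x z = 0)
    (hx : transv ω hω x 2 ∈ H) (hy : transv ω hω y 1 ∈ H) (hz : transv ω hω z 1 ∈ H) :
    transv ω hω (x + z) 2 ∈ H := by
  rw [← transv_sq_add_eq hω hxy hyz hxz]
  have hxy' := transv_add_mem hω hx hy hxy
  refine mul_mem (mul_mem (mul_mem (mul_mem (mul_mem hx hxy') (transv_sq_mem hω hy)) ?_) ?_)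
    (transv_sq_mem hω hz)
  · exact transv_add_mem hω hxy' hz (by simp [hxz, hyz])
  · exact transv_add_mem hω (transv_sq_mem hω hy) hz hyz

end Transvection

/-! ### Chains -/

section Chain

variable {M : Type*} [AddCommGroup M] {ω : LinearMap.BilinForm ℤ M}

/-- A chain of `N` vectors: consecutive ones pair to `1`, all others are orthogonal. -/
structure IsChain (ω : LinearMap.BilinForm ℤ M) (a : ℕ → M) (N : ℕ) : Prop where
  isAlt : ω.IsAlt
  adj : ∀ i, i + 1 < N → ω (a i) (a (i + 1)) = 1
  orth : ∀ i j, i + 1 < j → j < N → ω (a i) (a j) = 0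

/-- The sum of the `l + 1` consecutive members of a chain from the `i`-th on. -/
def chainSeg (a : ℕ → M) (i l : ℕ) : M := ∑ k ∈ Finset.range (l + 1), a (i + k)

/-- The sum of the first `m + 1` members of even index of a chain. -/
def chainE (a : ℕ → M) (m : ℕ) : M := ∑ k ∈ Finset.range (m + 1), a (2 * k)

/-- The members of odd index of a chain. -/
def chainF (a : ℕ → M) (m : ℕ) : M := a (2 * m + 1)

theorem chainE_succ (a : ℕ → M) (m : ℕ) : chainE a (m + 1) = chainE a m + a (2 * m + 2) :=
  Finset.sum_range_succ _ _

theorem chainSeg_succ (a : ℕ → M) (i l : ℕ) :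
    chainSeg a i (l + 1) = chainSeg a i l + a (i + l + 1) :=
  Finset.sum_range_succ _ _

namespace IsChain

variable {a : ℕ → M} {N : ℕ}

theorem apply_eq (hc : IsChain ω a N) {i j : ℕ} (hi : i < N) (hj : j < N) :
    ω (a i) (a j) = if i + 1 = j then 1 else if j + 1 = i then -1 else 0 := by
  have h := alt_swap hc.isAlt (a j) (a i)
  have h0 := hc.isAlt (a i)
  split_ifs with h1 h2
  · subst h1; exact hc.adj i hj
  · subst h2; rw [h, hc.adj j hi]
  · rcases lt_trichotomy i j with h3 | rfl | h3
    · exact hc.orth i j (by omega) hj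
    · exact h0
    · rw [h, hc.orth j i (by omega) hi, neg_zero]

/-- A member of odd index lying between two summands meets them with opposite signs, so only the
member just after the last summand survives. -/
theorem chainE_apply (hc : IsChain ω a N) {m j : ℕ} (hm : 2 * m < N) (hj : j < N) :
    ω (chainE a m) (a j) = if j = 2 * m + 1 then 1 else 0 := by
  induction m with
  | zero =>
    simp only [chainE, zero_add, Finset.sum_range_one, hc.apply_eq hm hj]
    split_ifs <;> omega
  | succ m ih =>
    rw [chainE_succ, map_add, LinearMap.add_apply, ih (by omega), hc.apply_eq (by omega) hj]
    split_ifs <;> omega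

theorem chainE_chainF (hc : IsChain ω a N) {i j : ℕ} (hi : 2 * i < N) (hj : 2 * j + 1 < N) :
    ω (chainE a i) (chainF a j) = if i = j then 1 else 0 := by
  rw [chainF, hc.chainE_apply hi hj]
  split_ifs <;> omega

theorem chainE_chainE (hc : IsChain ω a N) {i j : ℕ} (hi : 2 * i < N) (hj : 2 * j < N) :
    ω (chainE a i) (chainE a j) = 0 := by
  rw [chainE.eq_1 a j, map_sum]
  refine Finset.sum_eq_zero fun k hk => ?_
  have := Finset.mem_range.mp hk
  rw [hc.chainE_apply hi (by omega), if_neg (by omega)]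

theorem chainF_chainF (hc : IsChain ω a N) {i j : ℕ} (hi : 2 * i + 1 < N) (hj : 2 * j + 1 < N) :
    ω (chainF a i) (chainF a j) = 0 := by
  rw [chainF, chainF, hc.apply_eq hi hj]
  split_ifs <;> omega

theorem chainSeg_apply (hc : IsChain ω a N) {i l j : ℕ} (hij : i + l < j) (hj : j < N) :
    ω (chainSeg a i l) (a j) = if j = i + l + 1 then 1 else 0 := by
  induction l with
  | zero =>
    simp only [chainSeg, zero_add, Finset.sum_range_one, add_zero,
      hc.apply_eq (show i < N by omega) hj]
    split_ifs <;> omega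
  | succ l ih =>
    rw [chainSeg_succ, map_add, LinearMap.add_apply, ih (by omega), hc.apply_eq (by omega) hj]
    split_ifs <;> omega

theorem apply_chainSeg {x : M} {i l : ℕ} (hx : ∀ k, i < k → k ≤ i + l → ω x (a k) = 0) :
    ω x (chainSeg a i l) = ω x (a i) := by
  induction l with
  | zero => simp [chainSeg]
  | succ l ih =>
    rw [chainSeg_succ, map_add, ih fun k h1 h2 => hx k h1 (by omega), hx (i + l + 1) (by omega) (by omega),
      add_zero]

variable {H : Subgroup (M ≃ₗ[ℤ] M)}

theorem transv_chainSeg_mem (hc : IsChain ω a N)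
    (hH : ∀ i < N, transv ω hc.isAlt (a i) 1 ∈ H) {i l : ℕ} (h : i + l < N) :
    transv ω hc.isAlt (chainSeg a i l) 1 ∈ H := by
  induction l with
  | zero => simpa [chainSeg] using hH i h
  | succ l ih =>
    rw [chainSeg_succ]
    refine transv_add_mem _ (ih (by omega)) (hH _ h) ?_
    rw [hc.chainSeg_apply (by omega) (by omega), if_pos rfl]

/-- The next even member is absorbed by the full twist relation, the odd member between serving as
the middle vector. -/
theorem transv_chainE_mem (hc : IsChain ω a N)
    (hH : ∀ i < N, transv ω hc.isAlt (a i) 1 ∈ H) {i : ℕ} (hi : 2 * i < N) :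
    transv ω hc.isAlt (chainE a i) 2 ∈ H := by
  induction i with
  | zero => simpa [chainE] using transv_sq_mem _ (hH 0 hi)
  | succ i ih =>
    rw [chainE_succ]
    refine transv_sq_add_mem _ (y := a (2 * i + 1)) ?_ ?_ ?_ (ih (by omega)) (hH _ (by omega))
      (hH _ hi)
    · rw [hc.chainE_apply (by omega) (by omega), if_pos rfl]
    · exact hc.adj _ hi
    · rw [hc.chainE_apply (by omega) (by omega), if_neg (by omega)]

theorem transv_chainF_mem (hc : IsChain ω a N)
    (hH : ∀ i < N, transv ω hc.isAlt (a i) 1 ∈ H) {i : ℕ} (hi : 2 * i + 1 < N) :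
    transv ω hc.isAlt (chainF a i) 2 ∈ H :=
  transv_sq_mem _ (hH _ hi)

theorem transv_chainE_sub_mem (hc : IsChain ω a N)
    (hH : ∀ i < N, transv ω hc.isAlt (a i) 1 ∈ H) {i j : ℕ} (hij : i < j) (hj : 2 * j < N) :
    transv ω hc.isAlt (chainE a j - chainE a i) 2 ∈ H := by
  induction j, hij using Nat.le_induction with
  | base =>
    rw [Nat.succ_eq_add_one, chainE_succ, add_sub_cancel_left]
    exact transv_sq_mem _ (hH _ hj)
  | succ j hij ih =>
    rw [chainE_succ, add_sub_right_comm]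
    refine transv_sq_add_mem _ (y := a (2 * j + 1)) ?_ ?_ ?_ (ih (by omega)) (hH _ (by omega))
      (hH _ hj)
    · rw [map_sub, LinearMap.sub_apply, hc.chainE_apply (by omega) (by omega),
        hc.chainE_apply (by omega) (by omega), if_pos rfl, if_neg (by omega), sub_zero]
    · exact hc.adj _ hj
    · rw [map_sub, LinearMap.sub_apply, hc.chainE_apply (by omega) (by omega),
        hc.chainE_apply (by omega) (by omega), if_neg (by omega), if_neg (by omega), sub_zero]

/-- The segment a_i + ⋯ + a_{2j} bridges the gap between `x` and a_{2j+1}: it meets `x` only through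
its first member and a_{2j+1} only through its last, so it can be the middle vector of the full
twist relation. -/
theorem transv_add_chainF_mem (hc : IsChain ω a N)
    (hH : ∀ i < N, transv ω hc.isAlt (a i) 1 ∈ H) {x : M} {i j : ℕ} (hij : i ≤ 2 * j)
    (hj : 2 * j + 1 < N) (hx : transv ω hc.isAlt x 2 ∈ H) (h1 : ω x (a i) = 1)
    (h0 : ∀ k, i < k → k ≤ 2 * j + 1 → ω x (a k) = 0) :
    transv ω hc.isAlt (x + chainF a j) 2 ∈ H := by
  refine transv_sq_add_mem _ (y := chainSeg a i (2 * j - i)) ?_ ?_ (h0 _ (by omega) le_rfl) hx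
    (hc.transv_chainSeg_mem hH (by omega)) (hH _ hj)
  · rw [apply_chainSeg fun k h h' => h0 k h (by omega), h1]
  · rw [chainF, hc.chainSeg_apply (by omega) hj, if_pos (by omega)]

theorem transv_chainF_add_chainF_mem (hc : IsChain ω a N)
    (hH : ∀ i < N, transv ω hc.isAlt (a i) 1 ∈ H) {i j : ℕ} (hij : i < j) (hj : 2 * j + 1 < N) :
    transv ω hc.isAlt (chainF a i + chainF a j) 2 ∈ H :=
  hc.transv_add_chainF_mem hH (i := 2 * i + 2) (by omega) hj
    (hc.transv_chainF_mem hH (by omega)) (hc.adj _ (by omega))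
    fun k hk hk' => hc.orth _ _ (by omega) (by omega)

theorem transv_chainE_add_chainF_mem_of_lt (hc : IsChain ω a N)
    (hH : ∀ i < N, transv ω hc.isAlt (a i) 1 ∈ H) {i j : ℕ} (hij : i < j) (hj : 2 * j + 1 < N) :
    transv ω hc.isAlt (chainE a i + chainF a j) 2 ∈ H :=
  hc.transv_add_chainF_mem hH (i := 2 * i + 1) (by omega) hj
    (hc.transv_chainE_mem hH (by omega))
    (by rw [hc.chainE_apply (by omega) (by omega), if_pos rfl])
    fun k hk hk' => by rw [hc.chainE_apply (by omega) (by omega), if_neg (by omega)]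

theorem transv_chainE_add_chainF_mem (hc : IsChain ω a N)
    (hH : ∀ i < N, transv ω hc.isAlt (a i) 1 ∈ H) {i : ℕ} (hi : 2 * i + 1 < N) :
    transv ω hc.isAlt (chainE a i + chainF a i) 2 ∈ H :=
  transv_add_mem _ (hc.transv_chainE_mem hH (by omega)) (hH _ hi)
    (by rw [hc.chainE_chainF (by omega) hi, if_pos rfl])

/-- Since F_i pairs to 1 with a_{2i+2}, a plain conjugation passes from E_i + F_i to E_{i+1} + F_i.
Beyond that F_i is orthogonal to the new members, and each further even member is absorbed by the
full twist relation. -/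
theorem transv_chainE_add_chainF_mem_of_gt (hc : IsChain ω a N)
    (hH : ∀ i < N, transv ω hc.isAlt (a i) 1 ∈ H) {i j : ℕ} (hij : i < j) (hj : 2 * j < N) :
    transv ω hc.isAlt (chainE a j + chainF a i) 2 ∈ H := by
  have key : ∀ j k, i ≤ j → 2 * j < N → k < N → 2 * j < k →
      ω (chainE a j + chainF a i) (a k) = if k = 2 * j + 1 then 1 else
        if i = j ∧ k = 2 * j + 2 then 1 else 0 := by
    intro j k h1 h2 h3 h4
    rw [map_add, LinearMap.add_apply, hc.chainE_apply h2 h3, chainF, hc.apply_eq (by omega) h3]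
    split_ifs <;> omega
  induction j, hij using Nat.le_induction with
  | base =>
    rw [Nat.succ_eq_add_one, chainE_succ, add_right_comm]
    refine transv_add_mem _ (hc.transv_chainE_add_chainF_mem hH (by omega)) (hH _ hj) ?_
    rw [key i _ le_rfl (by omega) (by omega) (by omega), if_neg (by omega), if_pos ⟨rfl, rfl⟩]
  | succ j hij ih =>
    rw [chainE_succ, add_right_comm]
    refine transv_sq_add_mem _ (y := a (2 * j + 1)) ?_ (hc.adj _ hj) ?_ (ih (by omega))
      (hH _ (by omega)) (hH _ hj)
    · rw [key _ _ (by omega) (by omega) (by omega) (by omega), if_pos rfl]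
    · rw [key _ _ (by omega) (by omega) (by omega) (by omega), if_neg (by omega),
        if_neg (by omega)]

end IsChain
end Chain

/-! ### Generation of level 2 congruence subgroups by squares of transvections -/

/-- Division by 2|r|, with `a` shifted by |r| beforehand so that the remainder is centred at zero.
-/
theorem exists_abs_add_two_mul_le (a : ℤ) {r : ℤ} (hr : r ≠ 0) : ∃ k : ℤ, |a + 2 * k * r| ≤ |r| := by
  have h2 : 0 < 2 * |r| := by positivity
  have h3 := Int.emod_nonneg (a + |r|) h2.ne'
  have h4 := Int.emod_lt_of_pos (a + |r|) h2
  have h5 := Int.mul_ediv_add_emod (a + |r|) (2 * |r|)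
  have h6 : ∃ k : ℤ, 2 * k * r = -(2 * |r| * ((a + |r|) / (2 * |r|))) := by
    rcases abs_choice r with h | h <;> rw [h]
    · exact ⟨-((a + r) / (2 * r)), by ring⟩
    · exact ⟨(a + -r) / (2 * -r), by ring⟩
  obtain ⟨k, hk⟩ := h6
  refine ⟨k, ?_⟩
  rw [abs_le, hk]
  constructor <;> linarith

/-- Equality in the centred division would force `a` and `r` to have the same parity. This
strictness is what lets the Euclidean algorithm run with even multipliers. -/
theorem exists_abs_add_two_mul_lt {a r : ℤ} (hr : r ≠ 0) (h : ¬ (Even a ↔ Even r)) :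
    ∃ k : ℤ, |a + 2 * k * r| < |r| := by
  obtain ⟨k, hk⟩ := exists_abs_add_two_mul_le a hr
  refine ⟨k, lt_of_le_of_ne hk fun h' => h ?_⟩
  rw [← even_abs (a := r), ← h', even_abs, mul_assoc]
  simp [parity_simps]

/-! ### Eichler transformations, hyperbolic pairs and level 2 isometries. -/

section

variable {M : Type*} [AddCommGroup M] {ω : LinearMap.BilinForm ℤ M}

/-- For u orthogonal to b, the cross terms in the square along b + u (or u - b), isolated by
dividing out the squares along b and u, form the Eichler map x ↦ x + 2ω(x, b)u + 2ω(x, u)b.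
Composing such maps adds the vectors u up to an even multiple of ω(x, b)b, as in a Heisenberg group;
the uncontrolled integer `k` records this defect. -/
theorem exists_eichler (hω : ω.IsAlt) {K : Subgroup (M ≃ₗ[ℤ] M)} {b : M} {B : Set M}
    (hb : transv ω hω b 2 ∈ K)
    (hB : ∀ u ∈ B, ω u b = 0 ∧ transv ω hω u 2 ∈ K ∧
      (transv ω hω (b + u) 2 ∈ K ∨ transv ω hω (u - b) 2 ∈ K))
    {y : M} (hy : y ∈ AddSubgroup.closure B) :
    ω y b = 0 ∧ ∃ k : ℤ, ∃ h ∈ K, ∀ x, h x =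
      x + (2 * ω x b) • y + (2 * ω x y) • b + (2 * k * ω x b) • b := by
  induction hy using AddSubgroup.closure_induction with
  | mem u hu =>
    obtain ⟨h0, h1, h2⟩ := hB u hu
    have h0' : ω b u = 0 := by rw [alt_swap hω u b, h0, neg_zero]
    refine ⟨h0, 0, ?_⟩
    rcases h2 with h2 | h2
    · refine ⟨_, mul_mem h2 (inv_mem (mul_mem hb h1)), fun x => ?_⟩
      simp only [_root_.mul_inv_rev, transv_inv, LinearEquiv.mul_apply, transv_apply, map_add, map_smul,
        LinearMap.add_apply, LinearMap.smul_apply, hω b, hω u, h0, h0', smul_eq_mul]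
      module
    · refine ⟨_, mul_mem (inv_mem h2) (mul_mem hb h1), fun x => ?_⟩
      simp only [_root_.mul_inv_rev, transv_inv, LinearEquiv.mul_apply, transv_apply, map_add, map_sub,
        map_smul, LinearMap.add_apply, LinearMap.sub_apply, LinearMap.smul_apply, hω b, hω u, h0,
        h0', smul_eq_mul]
      module
  | zero => exact ⟨by simp, 0, 1, one_mem _, fun x => by simp⟩
  | add y z _ _ hy hz =>
    obtain ⟨hy0, k, h, hh, hk⟩ := hy
    obtain ⟨hz0, l, g, hg, hl⟩ := hz
    have hz1 : ω b y = 0 := by rw [alt_swap hω y b, hy0, neg_zero]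
    refine ⟨by simp [hy0, hz0], k + l + 2 * ω z y, h * g, mul_mem hh hg, fun x => ?_⟩
    simp only [LinearEquiv.mul_apply, hk, hl, map_add, map_smul, LinearMap.add_apply,
      LinearMap.smul_apply, hω b, hy0, hz0, hz1, smul_eq_mul]
    module
  | neg y _ hy =>
    obtain ⟨hy0, k, h, hh, hk⟩ := hy
    have hz1 : ω b y = 0 := by rw [alt_swap hω y b, hy0, neg_zero]
    refine ⟨by simp [hy0], -k, h⁻¹, inv_mem hh, fun x => ?_⟩
    rw [LinearEquiv.coe_inv, LinearEquiv.symm_apply_eq]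
    simp only [hk, map_add, map_neg, map_smul, LinearMap.add_apply,
      LinearMap.smul_apply, LinearMap.neg_apply, hω b, hω y, hy0, hz1, smul_eq_mul, neg_zero]
    module

/-- Families `e`, `f` whose first `s` members are a hyperbolic system. -/
structure IsHyperbolic {R M : Type*} [CommRing R] [AddCommGroup M] [Module R M]
    (ω : LinearMap.BilinForm R M) (e f : ℕ → M) (s : ℕ) : Prop where
  isAlt : ω.IsAlt
  ef : ∀ i < s, ∀ j < s, ω (e i) (f j) = if i = j then 1 else 0
  ee : ∀ i < s, ∀ j < s, ω (e i) (e j) = 0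
  ff : ∀ i < s, ∀ j < s, ω (f i) (f j) = 0

/-- The members of two families from the `m`-th to before the `s`-th. -/
def pairSet (e f : ℕ → M) (m s : ℕ) : Set M := {u | ∃ i, m ≤ i ∧ i < s ∧ (u = e i ∨ u = f i)}

/-- The subgroup generated by the members of two families from the `m`-th to before the `s`-th. -/
def pairSpan (e f : ℕ → M) (m s : ℕ) : AddSubgroup M := AddSubgroup.closure (pairSet e f m s)

variable {e f : ℕ → M} {s m : ℕ}

theorem left_mem_pairSpan {i : ℕ} (h : m ≤ i) (hi : i < s) : e i ∈ pairSpan e f m s :=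
  AddSubgroup.subset_closure ⟨i, h, hi, Or.inl rfl⟩

theorem right_mem_pairSpan {i : ℕ} (h : m ≤ i) (hi : i < s) : f i ∈ pairSpan e f m s :=
  AddSubgroup.subset_closure ⟨i, h, hi, Or.inr rfl⟩

theorem pairSpan_anti {m' : ℕ} (h : m ≤ m') : pairSpan e f m' s ≤ pairSpan e f m s :=
  AddSubgroup.closure_mono fun _ ⟨i, h1, h2, h3⟩ => ⟨i, h.trans h1, h2, h3⟩

namespace IsHyperbolic

theorem fe (hp : IsHyperbolic ω e f s) {i j : ℕ} (hi : i < s) (hj : j < s) :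
    ω (f i) (e j) = if i = j then -1 else 0 := by
  rw [alt_swap hp.isAlt (e j), hp.ef j hj i hi]
  split_ifs <;> first | rfl | omega

theorem apply_eq_zero (hp : IsHyperbolic ω e f s) {i : ℕ} {v : M} (hi : i < m) (hm : m ≤ s)
    (hv : v ∈ pairSpan e f m s) : ω v (e i) = 0 ∧ ω v (f i) = 0 := by
  induction hv using AddSubgroup.closure_induction with
  | mem u hu =>
    obtain ⟨j, hj, hjs, rfl | rfl⟩ := hu
    · rw [hp.ee j hjs i (by omega), hp.ef j hjs i (by omega), if_neg (by omega)]; simp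
    · rw [hp.ff j hjs i (by omega), hp.fe hjs (by omega), if_neg (by omega)]; simp
  | zero => simp
  | add x y _ _ hx hy => simp [hx.1, hx.2, hy.1, hy.2]
  | neg x _ hx => simp [hx.1, hx.2]

theorem expand (hp : IsHyperbolic ω e f s) {v : M} (hv : v ∈ pairSpan e f m s) :
    v = ∑ i ∈ Finset.Ico m s, (ω v (f i) • e i - ω v (e i) • f i) := by
  induction hv using AddSubgroup.closure_induction with
  | mem u hu =>
    obtain ⟨j, hj, hjs, rfl | rfl⟩ := hu
    · rw [Finset.sum_eq_single_of_mem j (Finset.mem_Ico.mpr ⟨hj, hjs⟩)]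
      · simp [hp.ef j hjs j hjs, hp.ee j hjs j hjs]
      · intro i hi hij
        have := (Finset.mem_Ico.mp hi).2
        simp [hp.ef j hjs i this, hp.ee j hjs i this, Ne.symm hij]
    · rw [Finset.sum_eq_single_of_mem j (Finset.mem_Ico.mpr ⟨hj, hjs⟩)]
      · simp [hp.fe hjs hjs, hp.ff j hjs j hjs]
      · intro i hi hij
        have := (Finset.mem_Ico.mp hi).2
        simp [hp.fe hjs this, hp.ff j hjs i this, Ne.symm hij]
  | zero => simp
  | add x y _ _ hx hy =>
    conv_lhs => rw [hx, hy, ← Finset.sum_add_distrib]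
    refine Finset.sum_congr rfl fun i _ => ?_
    simp only [map_add, LinearMap.add_apply]
    module
  | neg x _ hx =>
    conv_lhs => rw [hx, ← Finset.sum_neg_distrib]
    refine Finset.sum_congr rfl fun i _ => ?_
    simp only [map_neg, LinearMap.neg_apply]
    module

theorem mem_pairSpan_of_orthogonal (hp : IsHyperbolic ω e f s) {v : M}
    (hv : v ∈ pairSpan e f 0 s) (h : ∀ i < m, ω v (e i) = 0 ∧ ω v (f i) = 0) :
    v ∈ pairSpan e f m s := by
  rw [hp.expand hv]
  refine sum_mem fun i hi => ?_
  have his := (Finset.mem_Ico.mp hi).2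
  rcases lt_or_ge i m with him | him
  · simp [h i him]
  · exact sub_mem (zsmul_mem (left_mem_pairSpan him his) _)
      (zsmul_mem (right_mem_pairSpan him his) _)

/-- A vector decomposes along the `m`-th hyperbolic pair and its complement; if its coordinates
in the complement are even then so is its component there. -/
theorem exists_decomp (hp : IsHyperbolic ω e f s) (hm : m < s) {v : M}
    (hv : v ∈ pairSpan e f m s)
    (h : ∀ i, m < i → i < s → Even (ω v (e i)) ∧ Even (ω v (f i))) :
    ∃ y ∈ pairSpan e f (m + 1) s,
      v = ω v (f m) • e m - ω v (e m) • f m + (2 : ℤ) • y := by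
  refine ⟨∑ i ∈ Finset.Ico (m + 1) s, ((ω v (f i) / 2) • e i - (ω v (e i) / 2) • f i),
    sum_mem fun i hi => ?_, ?_⟩
  · obtain ⟨h1, h2⟩ := Finset.mem_Ico.mp hi
    exact sub_mem (zsmul_mem (left_mem_pairSpan h1 h2) _)
      (zsmul_mem (right_mem_pairSpan h1 h2) _)
  · conv_lhs => rw [hp.expand hv, Finset.sum_eq_sum_Ico_succ_bot hm]
    rw [Finset.smul_sum]
    congr 1
    refine Finset.sum_congr rfl fun i hi => ?_
    obtain ⟨h1, h2⟩ := Finset.mem_Ico.mp hi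
    obtain ⟨h3, h4⟩ := h i h1 h2
    rw [smul_sub, smul_smul, smul_smul, Int.two_mul_ediv_two_of_even h3,
      Int.two_mul_ediv_two_of_even h4]

end IsHyperbolic

/-- The isometries which are congruent to the identity modulo 2 on the span of the first `s`
hyperbolic pairs, and fix the first `m` pairs. -/
def levelTwo (ω : LinearMap.BilinForm ℤ M) (e f : ℕ → M) (s m : ℕ) : Subgroup (M ≃ₗ[ℤ] M) where
  carrier := {g | g ∈ isometries ω ∧
    (∀ v ∈ pairSpan e f 0 s, ∃ w ∈ pairSpan e f 0 s, g v = v + (2 : ℤ) • w) ∧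
    -- Requiring the congruence for the inverse as well makes closure under inversion immediate.
    (∀ v ∈ pairSpan e f 0 s, ∃ w ∈ pairSpan e f 0 s, g⁻¹ v = v + (2 : ℤ) • w) ∧
    ∀ i < m, g (e i) = e i ∧ g (f i) = f i}
  mul_mem' {g h} := by
    have key : ∀ g h : M ≃ₗ[ℤ] M,
        (∀ v ∈ pairSpan e f 0 s, ∃ w ∈ pairSpan e f 0 s, g v = v + (2 : ℤ) • w) →
        (∀ v ∈ pairSpan e f 0 s, ∃ w ∈ pairSpan e f 0 s, h v = v + (2 : ℤ) • w) →
        ∀ v ∈ pairSpan e f 0 s, ∃ w ∈ pairSpan e f 0 s, (g * h) v = v + (2 : ℤ) • w := by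
      intro g h hg hh v hv
      obtain ⟨w, hw, e1⟩ := hh v hv
      obtain ⟨w', hw', e2⟩ := hg v hv
      obtain ⟨w'', hw'', e3⟩ := hg w hw
      refine ⟨w' + w + (2 : ℤ) • w'', add_mem (add_mem hw' hw) (zsmul_mem hw'' _), ?_⟩
      rw [LinearEquiv.mul_apply, e1, map_add, map_smul, e2, e3]
      module
    rintro ⟨g1, g2, g3, g4⟩ ⟨h1, h2, h3, h4⟩
    refine ⟨mul_mem g1 h1, key g h g2 h2, ?_, fun i hi => ?_⟩
    · rw [_root_.mul_inv_rev]
      exact key _ _ h3 g3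
    · simp only [LinearEquiv.mul_apply, h4 i hi, g4 i hi, and_self]
  one_mem' := ⟨one_mem _, fun v _ => ⟨0, zero_mem _, by simp⟩,
    fun v _ => ⟨0, zero_mem _, by simp⟩, fun i _ => ⟨rfl, rfl⟩⟩
  inv_mem' {g} := by
    rintro ⟨g1, g2, g3, g4⟩
    refine ⟨inv_mem g1, g3, by rwa [inv_inv], fun i hi => ?_⟩
    simp only [LinearEquiv.coe_inv, LinearEquiv.symm_apply_eq, g4 i hi, and_self]

theorem transv_mem_levelTwo (hp : IsHyperbolic ω e f s) (hm : m ≤ s) {v : M}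
    (hv : v ∈ pairSpan e f m s) (k : ℤ) : transv ω hp.isAlt v (2 * k) ∈ levelTwo ω e f s m := by
  have hv' := pairSpan_anti (Nat.zero_le m) hv
  have key : ∀ k : ℤ, ∀ x ∈ pairSpan e f 0 s, ∃ w ∈ pairSpan e f 0 s,
      transv ω hp.isAlt v (2 * k) x = x + (2 : ℤ) • w := fun k x _ => by
    refine ⟨(k * ω x v) • v, zsmul_mem hv' _, ?_⟩
    rw [transv_apply]
    module
  refine ⟨transv_mem_isometries _ _ _, key k, ?_, fun i hi => ?_⟩
  · rw [transv_inv, ← mul_neg]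
    exact key (-k)
  · obtain ⟨h1, h2⟩ := hp.apply_eq_zero hi hm hv
    rw [transv_apply, transv_apply, alt_swap hp.isAlt v, h1, alt_swap hp.isAlt v (f i), h2]
    simp

/-- A group containing the squares of sufficiently many transvections along sums and differences
of members of hyperbolic pairs. -/
structure IsRich (hω : ω.IsAlt) (e f : ℕ → M) (s m : ℕ) (K : Subgroup (M ≃ₗ[ℤ] M)) :
    Prop where
  e_mem : ∀ i, m ≤ i → i < s → transv ω hω (e i) 2 ∈ K
  f_mem : ∀ i, m ≤ i → i < s → transv ω hω (f i) 2 ∈ K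
  ef_mem : ∀ i j, m ≤ i → m ≤ j → i < s → j < s → transv ω hω (e i + f j) 2 ∈ K
  ee_mem : ∀ i j, m ≤ i → i < j → j < s → transv ω hω (e j - e i) 2 ∈ K
  ff_mem : ∀ i j, m ≤ i → i < j → j < s → transv ω hω (f i + f j) 2 ∈ K

/-- Allows the reduction of the `m`-th pair to use only elements which leave the earlier pairs
untouched. -/
theorem IsRich.inf_levelTwo (hp : IsHyperbolic ω e f s) {K : Subgroup (M ≃ₗ[ℤ] M)}
    (hK : IsRich hp.isAlt e f s 0 K) (hm : m ≤ s) :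
    IsRich hp.isAlt e f s m (K ⊓ levelTwo ω e f s m) where
  e_mem i h hi := ⟨hK.e_mem i (Nat.zero_le _) hi,
    transv_mem_levelTwo hp hm (left_mem_pairSpan h hi) 1⟩
  f_mem i h hi := ⟨hK.f_mem i (Nat.zero_le _) hi,
    transv_mem_levelTwo hp hm (right_mem_pairSpan h hi) 1⟩
  ef_mem i j h h' hi hj := ⟨hK.ef_mem i j (Nat.zero_le _) (Nat.zero_le _) hi hj,
    transv_mem_levelTwo hp hm (add_mem (left_mem_pairSpan h hi) (right_mem_pairSpan h' hj)) 1⟩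
  ee_mem i j h hij hj := ⟨hK.ee_mem i j (Nat.zero_le _) hij hj,
    transv_mem_levelTwo hp hm (sub_mem (left_mem_pairSpan (by omega) hj)
      (left_mem_pairSpan h (by omega))) 1⟩
  ff_mem i j h hij hj := ⟨hK.ff_mem i j (Nat.zero_le _) hij hj,
    transv_mem_levelTwo hp hm (add_mem (right_mem_pairSpan h (by omega))
      (right_mem_pairSpan (by omega) hj)) 1⟩

namespace IsRich

variable {K : Subgroup (M ≃ₗ[ℤ] M)}

theorem eichler_e (hp : IsHyperbolic ω e f s) (hK : IsRich hp.isAlt e f s m K) (hm : m < s)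
    {y : M} (hy : y ∈ pairSpan e f (m + 1) s) :
    ∃ k : ℤ, ∃ h ∈ K, ∀ x, h x =
      x + (2 * ω x (e m)) • y + (2 * ω x y) • e m + (2 * k * ω x (e m)) • e m := by
  refine (exists_eichler hp.isAlt (hK.e_mem m le_rfl hm) ?_ hy).2
  rintro u ⟨i, h1, h2, rfl | rfl⟩
  · exact ⟨hp.ee i h2 m hm, hK.e_mem i (by omega) h2, Or.inr (hK.ee_mem m i le_rfl h1 h2)⟩
  · refine ⟨?_, hK.f_mem i (by omega) h2, Or.inl (hK.ef_mem m i le_rfl (by omega) hm h2)⟩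
    rw [hp.fe h2 hm, if_neg (by omega)]

theorem eichler_f (hp : IsHyperbolic ω e f s) (hK : IsRich hp.isAlt e f s m K) (hm : m < s)
    {y : M} (hy : y ∈ pairSpan e f (m + 1) s) :
    ∃ k : ℤ, ∃ h ∈ K, ∀ x, h x =
      x + (2 * ω x (f m)) • y + (2 * ω x y) • f m + (2 * k * ω x (f m)) • f m := by
  refine (exists_eichler hp.isAlt (hK.f_mem m le_rfl hm) ?_ hy).2
  rintro u ⟨i, h1, h2, rfl | rfl⟩
  · refine ⟨?_, hK.e_mem i (by omega) h2, Or.inl ?_⟩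
    · rw [hp.ef i h2 m hm, if_neg (by omega)]
    · rw [add_comm]; exact hK.ef_mem i m (by omega) le_rfl h2 hm
  · exact ⟨hp.ff i h2 m hm, hK.f_mem i (by omega) h2, Or.inl (hK.ff_mem m i le_rfl h1 h2)⟩

end IsRich

/-- Vectors of the span of the pairs from the `m`-th on which are primitive and congruent to `e m`
modulo 2. -/
structure IsColumn (ω : LinearMap.BilinForm ℤ M) (e f : ℕ → M) (s m : ℕ) (v : M) : Prop where
  mem : v ∈ pairSpan e f m s
  cong : ∃ w ∈ pairSpan e f 0 s, v = e m + (2 : ℤ) • w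
  prim : ∃ t, ω v t = 1

/-- An isometry fixing the first `m` pairs preserves orthogonality to them, and within the full span
this orthogonality characterizes the span of the remaining pairs. -/
theorem mem_pairSpan_of_mem_levelTwo (hp : IsHyperbolic ω e f s) (hm : m ≤ s) {g : M ≃ₗ[ℤ] M}
    (hg : g ∈ levelTwo ω e f s m) {v : M} (hv : v ∈ pairSpan e f m s) :
    g v ∈ pairSpan e f m s := by
  obtain ⟨w, hw, h⟩ := hg.2.1 v (pairSpan_anti (Nat.zero_le m) hv)
  refine hp.mem_pairSpan_of_orthogonal ?_ fun i hi => ?_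
  · rw [h]; exact add_mem (pairSpan_anti (Nat.zero_le m) hv) (zsmul_mem hw _)
  · have := hg.2.2.2 i hi
    have h' := hp.apply_eq_zero hi hm hv
    rw [← hg.1 v, ← hg.1 v (f i), this.1, this.2] at h'
    exact h'

theorem IsColumn.map (hp : IsHyperbolic ω e f s) (hm : m < s) {g : M ≃ₗ[ℤ] M}
    (hg : g ∈ levelTwo ω e f s m) {v : M} (hv : IsColumn ω e f s m v) :
    IsColumn ω e f s m (g v) := by
  obtain ⟨h1, ⟨w, hw, h2⟩, t, ht⟩ := hv
  refine ⟨mem_pairSpan_of_mem_levelTwo hp hm.le hg h1, ?_, g t, by rw [hg.1, ht]⟩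
  obtain ⟨w', hw', h3⟩ := hg.2.1 _ (left_mem_pairSpan (f := f) (Nat.zero_le m) hm)
  obtain ⟨w'', hw'', h4⟩ := hg.2.1 w hw
  refine ⟨w' + w + (2 : ℤ) • w'', add_mem (add_mem hw' hw) (zsmul_mem hw'' _), ?_⟩
  rw [h2, map_add, map_smul, h3, h4]
  module

namespace IsColumn

theorem odd (hp : IsHyperbolic ω e f s) (hm : m < s) {v : M} (hv : IsColumn ω e f s m v) :
    Odd (ω v (f m)) := by
  obtain ⟨w, hw, rfl⟩ := hv.cong
  exact ⟨ω w (f m), by simp [hp.ef m hm m hm, add_comm]⟩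

theorem even (hp : IsHyperbolic ω e f s) (hm : m < s) {v : M} (hv : IsColumn ω e f s m v) :
    Even (ω v (e m)) := by
  obtain ⟨w, hw, rfl⟩ := hv.cong
  exact ⟨ω w (e m), by simp [hp.ee m hm m hm, two_mul]⟩

theorem even_of_mem (hp : IsHyperbolic ω e f s) (hm : m < s) {v u : M}
    (hv : IsColumn ω e f s m v) (hu : u ∈ pairSpan e f (m + 1) s) : Even (ω v u) := by
  obtain ⟨w, hw, rfl⟩ := hv.cong
  refine ⟨ω w u, ?_⟩
  have := (hp.apply_eq_zero (Nat.lt_succ_self m) hm hu).1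
  simp [alt_swap hp.isAlt u (e m), this, two_mul]

end IsColumn

end

/-! ### Euclidean reduction of columns, and generation of the level 2 group. -/

section

variable {M : Type*} [AddCommGroup M] {ω : LinearMap.BilinForm ℤ M} {e f : ℕ → M} {s m : ℕ}
  {K : Subgroup (M ≃ₗ[ℤ] M)}

namespace IsColumn

/-- Two steps of Euclid's algorithm inside the plane of the `m`-th pair. With α = `ω v (f m)` odd
and β = `ω v (e m)` even, a power of the square along `f m` makes 0 < |β| < |α|, the
non-divisibility excluding 0; a power of the square along `e m` then brings |α| down to at most |β|.
-/
theorem exists_lt_of_not_dvd (hp : IsHyperbolic ω e f s) (hK : IsRich hp.isAlt e f s m K)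
    (hm : m < s) {v : M} (hv : IsColumn ω e f s m v)
    (h : ¬ 2 * ω v (f m) ∣ ω v (e m)) : ∃ g ∈ K, |ω (g v) (f m)| < |ω v (f m)| := by
  have ho := hv.odd hp hm
  have he := hv.even hp hm
  have h0 : ω v (f m) ≠ 0 := fun h0 => by simp [h0] at ho
  obtain ⟨k, hk⟩ := exists_abs_add_two_mul_lt (a := ω v (e m)) h0
    (by simp [he, ho])
  have h1 : ω v (e m) + 2 * k * ω v (f m) ≠ 0 := fun h1 => h ⟨-k, by linarith⟩
  obtain ⟨l, hl⟩ := exists_abs_add_two_mul_le (ω v (f m)) h1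
  refine ⟨_, mul_mem (transv_two_mul_mem _ (hK.e_mem m le_rfl hm) l)
    (transv_two_mul_mem _ (hK.f_mem m le_rfl hm) (-k)), lt_of_le_of_lt (le_of_eq ?_)
    (lt_of_le_of_lt hl hk)⟩
  congr 1
  simp only [LinearEquiv.mul_apply, transv_apply, map_add, map_smul, LinearMap.add_apply,
    LinearMap.smul_apply, hp.isAlt _, hp.ef m hm m hm, hp.fe hm hm, smul_eq_mul, if_true,
    Int.cast_id]
  ring

/-- The same two steps between α and a coordinate outside the `m`-th plane, with Eichler maps in
place of transvections. The partner `u'` of `u` is the direction which changes the coordinate `ω v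
u`. -/
theorem exists_lt_of_not_dvd_of_mem (hp : IsHyperbolic ω e f s) (hK : IsRich hp.isAlt e f s m K)
    (hKm : K ≤ levelTwo ω e f s m) (hm : m < s) {v u u' : M} (hv : IsColumn ω e f s m v)
    (hu : u ∈ pairSpan e f (m + 1) s) (hu' : u' ∈ pairSpan e f (m + 1) s) (huu : ω u' u = 1)
    (h : ¬ 2 * ω v (f m) ∣ ω v u) : ∃ g ∈ K, |ω (g v) (f m)| < |ω v (f m)| := by
  have ho := hv.odd hp hm
  have h0 : ω v (f m) ≠ 0 := fun h0 => by simp [h0] at ho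
  obtain ⟨hue, huf⟩ := hp.apply_eq_zero (Nat.lt_succ_self m) hm hu
  obtain ⟨hue', huf'⟩ := hp.apply_eq_zero (Nat.lt_succ_self m) hm hu'
  have hfu : ω (f m) u = 0 := by rw [alt_swap hp.isAlt u, huf, neg_zero]
  have heu : ω (e m) u = 0 := by rw [alt_swap hp.isAlt u, hue, neg_zero]
  obtain ⟨k, hk⟩ := exists_abs_add_two_mul_lt (a := ω v u) h0
    (by simp [hv.even_of_mem hp hm hu, ho])
  obtain ⟨k', g, hg, hgx⟩ := hK.eichler_f hp hm (zsmul_mem hu' k)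
  have hv1 := hv.map hp hm (hKm hg)
  have hf1 : ω (g v) (f m) = ω v (f m) := by
    simp [hgx, hp.isAlt (f m), huf']
  have hu1 : ω (g v) u = ω v u + 2 * k * ω v (f m) := by
    simp [hgx, hfu, huu]; ring
  -- The second Eichler map carries an uncontrolled term proportional to the pairing with `e m`.
  -- Either this pairing is a multiple of 2α and can first be made zero, or the descent inside the
  -- plane already applies.
  by_cases hd : 2 * ω (g v) (f m) ∣ ω (g v) (e m)
  · obtain ⟨j, hj⟩ := hd
    have hu0 : ω (g v) u ≠ 0 := by
      rw [hu1]; exact fun h1 => h ⟨-k, by linarith⟩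
    have ht : transv ω hp.isAlt (f m) (2 * j) ∈ K :=
      transv_two_mul_mem hp.isAlt (hK.f_mem m le_rfl hm) j
    obtain ⟨l, hl⟩ := exists_abs_add_two_mul_le (ω (g v) (f m)) hu0
    obtain ⟨l', g', hg', hgx'⟩ := hK.eichler_e hp hm (zsmul_mem hu l)
    refine ⟨_, mul_mem hg' (mul_mem ht hg), lt_of_le_of_lt (le_of_eq ?_)
      (lt_of_le_of_lt hl (hu1 ▸ hk))⟩
    congr 1
    have hj' : ω (g v) (e m) - 2 * j * ω (g v) (f m) = 0 := by rw [hj]; ring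
    rw [LinearEquiv.mul_apply, LinearEquiv.mul_apply, hgx']
    set w := transv ω hp.isAlt (f m) (2 * j) (g v) with hw
    have hw1 : ω w (e m) = 0 := by
      rw [hw, transv_apply]
      simp only [map_add, map_smul, LinearMap.add_apply, LinearMap.smul_apply, hp.fe hm hm,
        smul_eq_mul, if_true]
      linarith
    have hw2 : ω w (f m) = ω (g v) (f m) := by
      rw [hw, transv_apply]
      simp [hp.isAlt (f m)]
    have hw3 : ω w u = ω (g v) u := by
      rw [hw, transv_apply]
      simp [hfu]
    clear_value w
    simp [hw1, hw2, hw3, hp.ef m hm m hm]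
    ring
  · obtain ⟨g', hg', h'⟩ := hv1.exists_lt_of_not_dvd hp hK hm hd
    exact ⟨g' * g, mul_mem hg' hg, by rw [LinearEquiv.mul_apply]; rwa [hf1] at h'⟩

/-- Here α divides every coordinate, and primitivity forces α = ±1. The component outside the `m`-th
plane, then the one along `f m`, and finally the sign are removed. -/
theorem exists_map_eq_of_dvd (hp : IsHyperbolic ω e f s) (hK : IsRich hp.isAlt e f s m K)
    (hKm : K ≤ levelTwo ω e f s m) (hm : m < s) {v : M} (hv : IsColumn ω e f s m v)
    (he : ω v (f m) ∣ ω v (e m))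
    (h : ∀ i, m < i → i < s → ω v (f m) ∣ ω v (e i) ∧ ω v (f m) ∣ ω v (f i)) :
    ∃ g ∈ K, g v = e m := by
  have hα : ω v (f m) = 1 ∨ ω v (f m) = -1 := by
    obtain ⟨t, ht⟩ := hv.prim
    refine Int.isUnit_iff.mp (isUnit_of_dvd_one ?_)
    rw [← ht]
    conv_rhs => rw [hp.expand hv.mem]
    rw [map_sum, LinearMap.sum_apply]
    refine Finset.dvd_sum fun i hi => ?_
    obtain ⟨h1, h2⟩ := Finset.mem_Ico.mp hi
    rw [map_sub, LinearMap.sub_apply, map_smul, map_smul, LinearMap.smul_apply,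
      LinearMap.smul_apply, smul_eq_mul, smul_eq_mul]
    rcases h1.eq_or_lt with rfl | h1
    · exact dvd_sub (Dvd.intro _ rfl) (he.mul_right _)
    · exact dvd_sub ((h i h1 h2).2.mul_right _) ((h i h1 h2).1.mul_right _)
  have hα2 : ω v (f m) * ω v (f m) = 1 := by rcases hα with h | h <;> rw [h] <;> rfl
  obtain ⟨y, hy, hvy⟩ := hp.exists_decomp hm hv.mem fun i h1 h2 =>
    ⟨hv.even_of_mem hp hm (left_mem_pairSpan h1 h2), hv.even_of_mem hp hm (right_mem_pairSpan h1 h2)⟩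
  -- As α² = 1, the factor -α makes the Eichler map contribute exactly -2y.
  obtain ⟨k, g, hg, hgx⟩ := hK.eichler_f hp hm (zsmul_mem hy (-ω v (f m)))
  have hv1 := hv.map hp hm (hKm hg)
  obtain ⟨c, hc⟩ : ∃ c : ℤ, g v = ω v (f m) • e m + c • f m := by
    refine ⟨-ω v (e m) + 2 * ω v ((-ω v (f m)) • y) + 2 * k * ω v (f m), ?_⟩
    rw [hgx]
    nth_rw 1 [hvy]
    rw [smul_smul, show 2 * ω v (f m) * -ω v (f m) = -2 by linarith]
    module
  have hce : Even c := by
    have := hv1.even hp hm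
    rw [hc] at this
    simpa [hp.ee m hm m hm, hp.fe hm hm] using this
  obtain ⟨j, hj⟩ := hce
  have hg2 : ∃ g ∈ K, g v = ω v (f m) • e m := by
    refine ⟨_, mul_mem (transv_two_mul_mem hp.isAlt (hK.f_mem m le_rfl hm) (-(j * ω v (f m)))) hg, ?_⟩
    rw [LinearEquiv.mul_apply, hc, transv_apply, hj]
    simp only [map_add, map_smul, LinearMap.add_apply, LinearMap.smul_apply, hp.isAlt _,
      hp.ef m hm m hm, smul_eq_mul, if_true, Int.cast_id]
    rw [show 2 * -(j * ω v (f m)) * (ω v (f m) * 1 + (j + j) * 0) = -2 * j by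
      linear_combination (-2 * j) * hα2]
    module
  obtain ⟨g', hg', h'⟩ := hg2
  rcases hα with h1 | h1
  · exact ⟨g', hg', by rw [h', h1, one_smul]⟩
  -- The product of the squares along `f m`, `e m` and `e m + f m` acts as -1 on their plane, which
  -- repairs the sign.
  · refine ⟨_, mul_mem (mul_mem (mul_mem (hK.f_mem m le_rfl hm) (hK.e_mem m le_rfl hm))
      (hK.ef_mem m m le_rfl le_rfl hm hm)) hg', ?_⟩
    simp only [LinearEquiv.mul_apply, h', h1, transv_apply, map_add, map_smul, map_neg,
      LinearMap.add_apply, LinearMap.neg_apply,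
      LinearMap.smul_apply, hp.isAlt _, hp.ef m hm m hm, hp.fe hm hm, smul_eq_mul, if_true]
    module

/-- Descent on |α|. When no element of `K` lowers it, the two descent lemmas show that α divides all
other coordinates. -/
theorem exists_map_eq (hp : IsHyperbolic ω e f s) (hK : IsRich hp.isAlt e f s m K)
    (hKm : K ≤ levelTwo ω e f s m) (hm : m < s) {v : M} (hv : IsColumn ω e f s m v) :
    ∃ g ∈ K, g v = e m := by
  induction hn : (ω v (f m)).natAbs using Nat.strong_induction_on generalizing v with
  | _ n ih =>
    by_cases hd : ∃ g ∈ K, |ω (g v) (f m)| < |ω v (f m)|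
    · obtain ⟨g, hg, hlt⟩ := hd
      obtain ⟨g', hg', h'⟩ := ih _ (by rw [← hn]; zify; exact hlt) (hv.map hp hm (hKm hg)) rfl
      exact ⟨g' * g, mul_mem hg' hg, h'⟩
    · refine hv.exists_map_eq_of_dvd hp hK hKm hm ?_ fun i h1 h2 => ⟨?_, ?_⟩
      · by_contra hc
        exact hd (hv.exists_lt_of_not_dvd hp hK hm fun h => hc (dvd_of_mul_left_dvd h))
      · by_contra hc
        refine hd (hv.exists_lt_of_not_dvd_of_mem hp hK hKm hm (left_mem_pairSpan h1 h2)
          (neg_mem (right_mem_pairSpan h1 h2)) ?_ fun h => hc (dvd_of_mul_left_dvd h))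
        simp [hp.fe h2 h2]
      · by_contra hc
        refine hd (hv.exists_lt_of_not_dvd_of_mem hp hK hKm hm (right_mem_pairSpan h1 h2)
          (left_mem_pairSpan h1 h2) ?_ fun h => hc (dvd_of_mul_left_dvd h))
        simp [hp.ef i h2 i h2]

end IsColumn

/-- Once `e m` is in place, the condition `ω (e m) w = 1` makes the coefficient of `f m` in `w`
equal to 1. An Eichler map along `e m` removes the component in the later pairs, and a power of the
square along `e m` removes the rest; both fix `e m`. -/
theorem IsRich.exists_map_second (hp : IsHyperbolic ω e f s) (hK : IsRich hp.isAlt e f s m K)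
    (hm : m < s) {w : M} (hw : w ∈ pairSpan e f m s)
    (hw2 : ∃ x ∈ pairSpan e f 0 s, w = f m + (2 : ℤ) • x) (hew : ω (e m) w = 1) :
    ∃ g ∈ K, g (e m) = e m ∧ g w = f m := by
  have hwe : ω w (e m) = -1 := by rw [alt_swap hp.isAlt (e m), hew]
  obtain ⟨x, hx, hwx⟩ := hw2
  have hev : ∀ u, ω (f m) u = 0 → Even (ω w u) := fun u hu =>
    ⟨ω x u, by rw [hwx]; simp [hu, two_mul]⟩
  obtain ⟨y, hy, hwy⟩ := hp.exists_decomp hm hw fun i h1 h2 =>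
    ⟨hev _ (by rw [hp.fe hm h2, if_neg (by omega)]), hev _ (hp.ff m hm i h2)⟩
  obtain ⟨j, hj⟩ := hev (f m) (hp.isAlt _)
  obtain ⟨k, g, hg, hgx⟩ := hK.eichler_e hp hm hy
  have hye : ω (e m) y = 0 := by
    rw [alt_swap hp.isAlt y, (hp.apply_eq_zero (Nat.lt_succ_self m) hm hy).1, neg_zero]
  -- The exponent is half the surviving coefficient of `e m`: 2j comes from `w`, and 2ω(w, y) - 2k
  -- from the Eichler map.
  refine ⟨_, mul_mem (transv_two_mul_mem hp.isAlt (hK.e_mem m le_rfl hm) (j + ω w y - k)) hg, ?_, ?_⟩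
  · rw [LinearEquiv.mul_apply, hgx, transv_apply]
    simp [hp.isAlt (e m), hye]
  · have h1 : g w = f m + (2 * (j + ω w y - k)) • e m := by
      rw [hgx, hwe]
      nth_rw 1 [hwy]
      rw [hwe, hj]
      module
    rw [LinearEquiv.mul_apply, h1, transv_apply]
    simp only [map_add, map_smul, LinearMap.add_apply, LinearMap.smul_apply, hp.isAlt _,
      hp.fe hm hm, smul_eq_mul, if_true, Int.cast_id]
    module

/-- Column reduction, one hyperbolic pair at a time. Multiplying `g` by elements of `H` restores `e
m` and then `f m`, which moves it from level `m` to level `m + 1`; at level `s` it is the identity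
on the span. -/
theorem IsRich.exists_eqOn (hp : IsHyperbolic ω e f s) {H : Subgroup (M ≃ₗ[ℤ] M)}
    (hH : IsRich hp.isAlt e f s 0 H) (hm : m ≤ s) {g : M ≃ₗ[ℤ] M} (hg : g ∈ levelTwo ω e f s m) :
    ∃ h ∈ H, ∀ v ∈ pairSpan e f 0 s, h v = g v := by
  induction hm using Nat.decreasingInduction generalizing g with
  | self =>
    refine ⟨1, one_mem _, fun v hv => ?_⟩
    induction hv using AddSubgroup.closure_induction with
    | mem u hu =>
      obtain ⟨j, -, hj, rfl | rfl⟩ := hu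
      · exact (hg.2.2.2 j hj).1.symm
      · exact (hg.2.2.2 j hj).2.symm
    | zero => simp
    | add x y _ _ hx hy => rw [map_add, map_add, hx, hy]
    | neg x _ hx => rw [map_neg, map_neg, hx]
  | of_succ m hm ih =>
    have hK := hH.inf_levelTwo hp hm.le
    have he := left_mem_pairSpan (f := f) (e := e) le_rfl hm
    have hf := right_mem_pairSpan (f := f) (e := e) le_rfl hm
    have hcol : IsColumn ω e f s m (g (e m)) :=
      ⟨mem_pairSpan_of_mem_levelTwo hp hm.le hg he,
        hg.2.1 _ (left_mem_pairSpan (Nat.zero_le _) hm),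
        g (f m), by rw [hg.1, hp.ef m hm m hm, if_pos rfl]⟩
    obtain ⟨h₁, hh₁, e₁⟩ := hcol.exists_map_eq hp hK inf_le_right hm
    have hg₁ := mul_mem hh₁.2 hg
    obtain ⟨h₂, hh₂, e₂, e₃⟩ := hK.exists_map_second hp hm
      (mem_pairSpan_of_mem_levelTwo hp hm.le hg₁ hf)
      (hg₁.2.1 _ (right_mem_pairSpan (Nat.zero_le _) hm)) (by
        have := hg₁.1 (e m) (f m)
        rwa [hp.ef m hm m hm, if_pos rfl, LinearEquiv.mul_apply, e₁] at this)
    have hg₂ := mul_mem hh₂.2 hg₁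
    obtain ⟨h, hh, hv⟩ := ih (g := h₂ * (h₁ * g)) ⟨hg₂.1, hg₂.2.1, hg₂.2.2.1, fun i hi => by
      rcases (Nat.lt_succ_iff.mp hi).eq_or_lt with rfl | hi
      · exact ⟨by rw [LinearEquiv.mul_apply, LinearEquiv.mul_apply, e₁, e₂],
          by rw [LinearEquiv.mul_apply, e₃]⟩
      · exact hg₂.2.2.2 i hi⟩
    refine ⟨(h₂ * h₁)⁻¹ * h, mul_mem (inv_mem (mul_mem hh₂.1 hh₁.1)) hh, fun v hv' => ?_⟩
    rw [LinearEquiv.mul_apply, hv v hv', ← mul_assoc, ← LinearEquiv.mul_apply, ← mul_assoc,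
      inv_mul_cancel, one_mul]

/-! ### The level 2 group generated along a chain. -/

namespace IsChain

variable {a : ℕ → M}

theorem isHyperbolic (hc : IsChain ω a (2 * s)) : IsHyperbolic ω (chainE a) (chainF a) s where
  isAlt := hc.isAlt
  ef i hi j hj := hc.chainE_chainF (by omega) (by omega)
  ee i hi j hj := hc.chainE_chainE (by omega) (by omega)
  ff i hi j hj := hc.chainF_chainF (by omega) (by omega)

theorem isRich (hc : IsChain ω a (2 * s)) {H : Subgroup (M ≃ₗ[ℤ] M)}
    (hH : ∀ i < 2 * s, transv ω hc.isAlt (a i) 1 ∈ H) :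
    IsRich hc.isAlt (chainE a) (chainF a) s 0 H where
  e_mem i _ hi := hc.transv_chainE_mem hH (by omega)
  f_mem i _ hi := hc.transv_chainF_mem hH (by omega)
  ef_mem i j _ _ hi hj := by
    rcases lt_trichotomy i j with h | rfl | h
    · exact hc.transv_chainE_add_chainF_mem_of_lt hH h (by omega)
    · exact hc.transv_chainE_add_chainF_mem hH (by omega)
    · exact hc.transv_chainE_add_chainF_mem_of_gt hH h (by omega)
  ee_mem i j _ h hj := hc.transv_chainE_sub_mem hH h (by omega)
  ff_mem i j _ h hj := hc.transv_chainF_add_chainF_mem hH h (by omega)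

/-- A group containing the transvections along a chain of even length contains the level 2
congruence subgroup of the symplectic group of the span of the chain, up to the action outside
of the span. -/
theorem exists_eqOn (hc : IsChain ω a (2 * s)) {H : Subgroup (M ≃ₗ[ℤ] M)}
    (hH : ∀ i < 2 * s, transv ω hc.isAlt (a i) 1 ∈ H) {g : M ≃ₗ[ℤ] M}
    (hg : g ∈ levelTwo ω (chainE a) (chainF a) s 0) :
    ∃ h ∈ H, ∀ v ∈ pairSpan (chainE a) (chainF a) 0 s, h v = g v :=
  (hc.isRich hH).exists_eqOn hc.isHyperbolic (Nat.zero_le _) hg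

theorem mem_pairSpan {i : ℕ} (hi : i < 2 * s) :
    a i ∈ pairSpan (chainE a) (chainF a) 0 s := by
  obtain ⟨k, rfl | rfl⟩ := i.even_or_odd'
  · rcases k with _ | k
    · simpa [chainE] using
        left_mem_pairSpan (e := chainE a) (f := chainF a) (m := 0) le_rfl (show 0 < s by omega)
    · have h := chainE_succ a k
      rw [mul_add_one, ← sub_eq_of_eq_add' h]
      exact sub_mem (left_mem_pairSpan (Nat.zero_le _) (by omega))
        (left_mem_pairSpan (Nat.zero_le _) (by omega))
  · exact right_mem_pairSpan (e := chainE a) (Nat.zero_le _) (by omega)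

end IsChain

end

/-! ### The order of the symplectic group over the field with two elements -/

section

variable {V : Type*} [AddCommGroup V] [Module (ZMod 2) V]

/-- Orbit-stabilizer. Describing orbit and stabilizer by membership keeps successive stabilizers
subgroups of one fixed group. -/
theorem card_eq_ncard_orbit_mul {K K' : Subgroup (V ≃ₗ[ZMod 2] V)} {x : V} {S : Set V}
    (hS : ∀ v, v ∈ S ↔ ∃ g ∈ K, g x = v) (hK' : ∀ g, g ∈ K' ↔ g ∈ K ∧ g x = x) :
    Nat.card K = S.ncard * Nat.card K' := by
  have h1 : MulAction.orbit K x = S := by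
    ext v
    rw [hS]
    exact ⟨fun ⟨g, hg⟩ => ⟨g, g.2, hg⟩, fun ⟨g, hg, h⟩ => ⟨⟨g, hg⟩, h⟩⟩
  have h2 : K' = (MulAction.stabilizer K x).map K.subtype := by
    ext g
    rw [hK', Subgroup.mem_map]
    exact ⟨fun ⟨h, h'⟩ => ⟨⟨g, h⟩, h', rfl⟩, by rintro ⟨⟨g, h⟩, h', rfl⟩; exact ⟨h, h'⟩⟩
  rw [h2, ← Nat.card_congr ((MulAction.stabilizer K x).equivMapOfInjective K.subtype
    K.subtype_injective).toEquiv, ← h1, ← MulAction.index_stabilizer, mul_comm,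
    Subgroup.card_mul_index]

/-- The orthogonal complement of the first `m` hyperbolic pairs. -/
def pairPerp (ω : LinearMap.BilinForm (ZMod 2) V) (e f : ℕ → V) (m : ℕ) : Set V :=
  {v | ∀ i < m, ω v (e i) = 0 ∧ ω v (f i) = 0}

/-- The members of a group which fix the first `m` hyperbolic pairs. -/
def fixPairs (Γ : Subgroup (V ≃ₗ[ZMod 2] V)) (e f : ℕ → V) (m : ℕ) :
    Subgroup (V ≃ₗ[ZMod 2] V) where
  carrier := {g | g ∈ Γ ∧ ∀ i < m, g (e i) = e i ∧ g (f i) = f i}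
  mul_mem' := fun ⟨g1, g2⟩ ⟨h1, h2⟩ => ⟨mul_mem g1 h1, fun i hi => by
    simp only [LinearEquiv.mul_apply, h2 i hi, g2 i hi, and_self]⟩
  one_mem' := ⟨one_mem _, fun i _ => ⟨rfl, rfl⟩⟩
  inv_mem' := fun ⟨g1, g2⟩ => ⟨inv_mem g1, fun i hi => by
    simp only [LinearEquiv.coe_inv, LinearEquiv.symm_apply_eq, g2 i hi, and_self]⟩

variable {ω : LinearMap.BilinForm (ZMod 2) V} {e f : ℕ → V} {s m : ℕ}

theorem zmod2_eq_one {a : ZMod 2} (h : a ≠ 0) : a = 1 := by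
  revert a; decide

theorem add_self_zmod2 (v : V) : v + v = 0 := by
  rw [← two_smul (ZMod 2) v, show (2 : ZMod 2) = 0 from rfl, zero_smul]

theorem alt_comm (hω : ω.IsAlt) (x y : V) : ω x y = ω y x := by
  rw [alt_swap hω y x, ZMod.neg_eq_self_mod_two]

theorem add_mem_pairPerp {x y : V} (hx : x ∈ pairPerp ω e f m) (hy : y ∈ pairPerp ω e f m) :
    x + y ∈ pairPerp ω e f m := fun i hi => by
  simp [hx i hi, hy i hi]

theorem smul_mem_pairPerp {x : V} (c : ZMod 2) (hx : x ∈ pairPerp ω e f m) :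
    c • x ∈ pairPerp ω e f m := fun i hi => by
  simp [hx i hi]

theorem pairPerp_succ_subset : pairPerp ω e f (m + 1) ⊆ pairPerp ω e f m :=
  fun _ h i hi => h i (by omega)

namespace IsHyperbolic

theorem fe_two (hp : IsHyperbolic ω e f s) {i j : ℕ} (hi : i < s) (hj : j < s) :
    ω (f i) (e j) = if i = j then 1 else 0 := by
  rw [alt_comm hp.isAlt, hp.ef j hj i hi]
  simp only [eq_comm]

theorem left_mem_pairPerp (hp : IsHyperbolic ω e f s) (hm : m < s) : e m ∈ pairPerp ω e f m :=
  fun i hi => ⟨hp.ee m hm i (by omega), by rw [hp.ef m hm i (by omega), if_neg (by omega)]⟩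

theorem right_mem_pairPerp (hp : IsHyperbolic ω e f s) (hm : m < s) : f m ∈ pairPerp ω e f m :=
  fun i hi => ⟨by rw [hp.fe_two hm (by omega), if_neg (by omega)], hp.ff m hm i (by omega)⟩

theorem add_mem_pairPerp_succ (hp : IsHyperbolic ω e f s) (hm : m < s) {v : V}
    (hv : v ∈ pairPerp ω e f m) : v + ω v (f m) • e m + ω v (e m) • f m ∈ pairPerp ω e f (m + 1) := by
  intro i hi
  rcases (Nat.lt_succ_iff.mp hi).eq_or_lt with rfl | hi
  · simp [hp.ef i hm i hm, hp.ee i hm i hm, hp.ff i hm i hm, hp.fe_two hm hm, CharTwo.add_self_eq_zero]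
  · simp [hv i hi, hp.left_mem_pairPerp hm i hi, hp.right_mem_pairPerp hm i hi]

/-- The complement splits off the plane of the `m`-th pair, which has four vectors. -/
theorem ncard_pairPerp (hp : IsHyperbolic ω e f s) (hm : m < s) :
    (pairPerp ω e f m).ncard = 4 * (pairPerp ω e f (m + 1)).ncard := by
  have h : pairPerp ω e f m = (fun p : (ZMod 2 × ZMod 2) × V => p.2 + p.1.1 • e m + p.1.2 • f m) ''
      (Set.univ ×ˢ pairPerp ω e f (m + 1)) := by
    ext v
    constructor
    · intro hv
      refine ⟨((ω v (f m), ω v (e m)), _), ⟨trivial, hp.add_mem_pairPerp_succ hm hv⟩, ?_⟩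
      have h1 := add_self_zmod2 (ω v (f m) • e m)
      have h2 := add_self_zmod2 (ω v (e m) • f m)
      calc _ = v + (ω v (f m) • e m + ω v (f m) • e m) + (ω v (e m) • f m + ω v (e m) • f m) := by
            dsimp only; abel
        _ = v := by rw [h1, h2, add_zero, add_zero]
    · rintro ⟨⟨⟨a, b⟩, u⟩, ⟨-, hu⟩, rfl⟩
      exact add_mem_pairPerp (add_mem_pairPerp (pairPerp_succ_subset hu)
        (smul_mem_pairPerp _ (hp.left_mem_pairPerp hm)))
        (smul_mem_pairPerp _ (hp.right_mem_pairPerp hm))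
  rw [h, Set.InjOn.ncard_image, Set.ncard_prod, Set.ncard_univ]
  · simp
  · rintro ⟨⟨a, b⟩, u⟩ ⟨-, hu⟩ ⟨⟨a', b'⟩, u'⟩ ⟨-, hu'⟩ h
    have hu := hu m (Nat.lt_succ_self m)
    have hu' := hu' m (Nat.lt_succ_self m)
    dsimp only at h hu hu'
    have h1 := congrArg (fun x => ω x (f m)) h
    have h2 := congrArg (fun x => ω x (e m)) h
    simp [hu, hu', hp.ef m hm m hm, hp.ff m hm m hm] at h1
    simp [hu, hu', hp.ee m hm m hm, hp.fe_two hm hm] at h2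
    subst h1 h2
    simpa using h

/-- The condition fixes the coefficient of `f m`, leaving two choices for that of `e m`. -/
theorem ncard_pairPerp_one (hp : IsHyperbolic ω e f s) (hm : m < s) :
    {w | w ∈ pairPerp ω e f m ∧ ω w (e m) = 1}.ncard = 2 * (pairPerp ω e f (m + 1)).ncard := by
  have h : {w | w ∈ pairPerp ω e f m ∧ ω w (e m) = 1} =
      (fun p : ZMod 2 × V => p.2 + p.1 • e m + f m) '' (Set.univ ×ˢ pairPerp ω e f (m + 1)) := by
    ext v
    constructor
    · rintro ⟨hv, hv1⟩
      refine ⟨(ω v (f m), _), ⟨trivial, hp.add_mem_pairPerp_succ hm hv⟩, ?_⟩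
      have h1 := add_self_zmod2 (ω v (f m) • e m)
      have h2 := add_self_zmod2 (f m)
      calc _ = v + (ω v (f m) • e m + ω v (f m) • e m) + (f m + f m) := by
            dsimp only; rw [hv1, one_smul]; abel
        _ = v := by rw [h1, h2, add_zero, add_zero]
    · rintro ⟨⟨a, u⟩, ⟨-, hu⟩, rfl⟩
      have hu1 := hu m (Nat.lt_succ_self m)
      refine ⟨add_mem_pairPerp (add_mem_pairPerp (pairPerp_succ_subset hu)
        (smul_mem_pairPerp _ (hp.left_mem_pairPerp hm))) (hp.right_mem_pairPerp hm), ?_⟩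
      dsimp only at hu1 ⊢
      simp [hu1, hp.ee m hm m hm, hp.fe_two hm hm]
  rw [h, Set.InjOn.ncard_image, Set.ncard_prod, Set.ncard_univ]
  · simp
  · rintro ⟨a, u⟩ ⟨-, hu⟩ ⟨a', u'⟩ ⟨-, hu'⟩ h
    have hu := hu m (Nat.lt_succ_self m)
    have hu' := hu' m (Nat.lt_succ_self m)
    dsimp only at h hu hu'
    have h1 := congrArg (fun x => ω x (f m)) h
    simp [hu, hu', hp.ef m hm m hm, hp.ff m hm m hm] at h1
    subst h1
    simpa using h

/-- Nondegeneracy passes to the complement: projecting a partner of `v` off the `m`-th plane does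
not change its pairing with `v`. -/
theorem exists_apply_eq_one (hp : IsHyperbolic ω e f s)
    (hs : ∀ v ∈ pairPerp ω e f s, v = 0) (hm : m ≤ s) {v : V} (hv : v ∈ pairPerp ω e f m)
    (hv0 : v ≠ 0) : ∃ a ∈ pairPerp ω e f m, ω v a = 1 := by
  induction m with
  | zero =>
    by_contra! h
    refine hv0 (hs v fun i _ => ⟨?_, ?_⟩) <;> by_contra h' <;>
      exact h _ (fun _ h => by omega) (zmod2_eq_one h')
  | succ m ih =>
    obtain ⟨a, ha, hva⟩ := ih (by omega) (pairPerp_succ_subset hv)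
    refine ⟨_, hp.add_mem_pairPerp_succ (by omega) ha, ?_⟩
    simp [hva, hv m (Nat.lt_succ_self m)]

theorem exists_apply_eq_one₂ (hp : IsHyperbolic ω e f s)
    (hs : ∀ v ∈ pairPerp ω e f s, v = 0) (hm : m ≤ s) {v w : V} (hv : v ∈ pairPerp ω e f m)
    (hv0 : v ≠ 0) (hw : w ∈ pairPerp ω e f m) (hw0 : w ≠ 0) :
    ∃ a ∈ pairPerp ω e f m, ω v a = 1 ∧ ω w a = 1 := by
  obtain ⟨a, ha, hva⟩ := hp.exists_apply_eq_one hs hm hv hv0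
  obtain ⟨b, hb, hwb⟩ := hp.exists_apply_eq_one hs hm hw hw0
  by_cases h1 : ω w a = 0
  · by_cases h2 : ω v b = 0
    · exact ⟨a + b, add_mem_pairPerp ha hb, by simp [hva, h2], by simp [hwb, h1]⟩
    · exact ⟨b, hb, zmod2_eq_one h2, hwb⟩
  · exact ⟨a, ha, hva, zmod2_eq_one h1⟩

variable {Γ : Subgroup (V ≃ₗ[ZMod 2] V)}

theorem transv_mem_fixPairs (hp : IsHyperbolic ω e f s) (hΓ : ∀ v, transv ω hp.isAlt v 1 ∈ Γ)
    {v : V} (hv : v ∈ pairPerp ω e f m) : transv ω hp.isAlt v 1 ∈ fixPairs Γ e f m :=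
  ⟨hΓ v, fun i hi => by
    simp [transv_apply, alt_comm hp.isAlt (e i), alt_comm hp.isAlt (f i), hv i hi]⟩

theorem transv_add_apply (hω : ω.IsAlt) {v w : V} (h : ω v w = 1) :
    transv ω hω (v + w) 1 v = w := by
  rw [transv_apply, map_add, hω v, h, zero_add, mul_one, one_smul, ← add_assoc, add_self_zmod2,
    zero_add]

theorem mem_pairPerp_of_mem_fixPairs (hΓ' : Γ ≤ isometries ω) {g : V ≃ₗ[ZMod 2] V}
    (hg : g ∈ fixPairs Γ e f m) {v : V} (hv : v ∈ pairPerp ω e f m) :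
    g v ∈ pairPerp ω e f m := fun i hi => by
  have h := hv i hi
  rwa [← hΓ' hg.1 v, ← hΓ' hg.1 v (f i), (hg.2 i hi).1, (hg.2 i hi).2] at h

/-- Transvections act transitively on the possible images of `e m`, and those fixing `e m` act
transitively on the possible images of `f m`. If ω(v, w) = 1, the transvection along v + w takes v
to w; otherwise an intermediate vector pairing to 1 with both is used. -/
theorem card_fixPairs_eq (hp : IsHyperbolic ω e f s) (hs : ∀ v ∈ pairPerp ω e f s, v = 0)
    (hΓ' : Γ ≤ isometries ω) (hΓ : ∀ v, transv ω hp.isAlt v 1 ∈ Γ) (hm : m < s) :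
    Nat.card (fixPairs Γ e f m) = (pairPerp ω e f m \ {0}).ncard *
      ({w | w ∈ pairPerp ω e f m ∧ ω w (e m) = 1}.ncard * Nat.card (fixPairs Γ e f (m + 1))) := by
  have he := hp.left_mem_pairPerp hm
  have hf := hp.right_mem_pairPerp hm
  have hef := hp.ef m hm m hm
  rw [if_pos rfl] at hef
  have he0 : e m ≠ 0 := fun h => by simp [h] at hef
  let K' : Subgroup (V ≃ₗ[ZMod 2] V) :=
    fixPairs Γ e f m ⊓ MulAction.stabilizer (V ≃ₗ[ZMod 2] V) (e m)
  have h2 : Nat.card K' =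
      {w | w ∈ pairPerp ω e f m ∧ ω w (e m) = 1}.ncard * Nat.card (fixPairs Γ e f (m + 1)) := by
    refine card_eq_ncard_orbit_mul (x := f m) (fun v => ⟨?_, ?_⟩) fun g => ⟨?_, ?_⟩
    · rintro ⟨hv, hv1⟩
      rw [alt_comm hp.isAlt] at hv1
      have key : ∀ x y, x ∈ pairPerp ω e f m → y ∈ pairPerp ω e f m → ω (e m) x = 1 →
          ω (e m) y = 1 → ω x y = 1 → ∃ g ∈ K', g x = y := fun x y hx hy h1 h2 h3 => by
        refine ⟨_, ⟨hp.transv_mem_fixPairs hΓ (add_mem_pairPerp hx hy), ?_⟩,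
          transv_add_apply hp.isAlt h3⟩
        change transv ω hp.isAlt (x + y) 1 (e m) = e m
        simp [transv_apply, h1, h2, CharTwo.add_self_eq_zero]
      by_cases h : ω (f m) v = 0
      -- The intermediate vector is `e m + f m`: it pairs to 1 with `f m`, with `v` and with `e m`.
      · obtain ⟨g, hg, h1⟩ := key (f m) (e m + f m) hf (add_mem_pairPerp he hf) hef
          (by simp [hef, hp.isAlt (e m)]) (by simp [hp.isAlt (f m), hp.fe_two hm hm])
        obtain ⟨g', hg', h2⟩ := key (e m + f m) v (add_mem_pairPerp he hf) hv
          (by simp [hef, hp.isAlt (e m)]) hv1 (by simp [h, hv1])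
        exact ⟨g' * g, mul_mem hg' hg, by rw [LinearEquiv.mul_apply, h1, h2]⟩
      · exact key _ _ hf hv hef hv1 (zmod2_eq_one h)
    · rintro ⟨g, ⟨hg, hg'⟩, rfl⟩
      refine ⟨mem_pairPerp_of_mem_fixPairs hΓ' hg hf, ?_⟩
      have h := hΓ' hg.1 (f m) (e m)
      rwa [show g (e m) = e m from hg', hp.fe_two hm hm, if_pos rfl] at h
    · exact fun h => ⟨⟨⟨h.1, fun i hi => h.2 i (by omega)⟩, (h.2 m (by omega)).1⟩,
        (h.2 m (by omega)).2⟩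
    · rintro ⟨⟨h1, h2⟩, h3⟩
      refine ⟨h1.1, fun i hi => ?_⟩
      rcases (Nat.lt_succ_iff.mp hi).eq_or_lt with rfl | hi
      · exact ⟨h2, h3⟩
      · exact h1.2 i hi
  rw [← h2]
  refine card_eq_ncard_orbit_mul (x := e m) (fun v => ⟨?_, ?_⟩) fun g => Iff.rfl
  · rintro ⟨hv, hv0⟩
    by_cases h : ω (e m) v = 0
    · obtain ⟨a, ha, h1, h2⟩ := hp.exists_apply_eq_one₂ hs hm.le he he0 hv hv0
      rw [alt_comm hp.isAlt] at h2
      refine ⟨_, mul_mem (hp.transv_mem_fixPairs hΓ (add_mem_pairPerp ha hv))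
        (hp.transv_mem_fixPairs hΓ (add_mem_pairPerp he ha)), ?_⟩
      rw [LinearEquiv.mul_apply, transv_add_apply _ h1, transv_add_apply _ h2]
    · exact ⟨_, hp.transv_mem_fixPairs hΓ (add_mem_pairPerp he hv),
        transv_add_apply _ (zmod2_eq_one h)⟩
  · rintro ⟨g, hg, rfl⟩
    exact ⟨mem_pairPerp_of_mem_fixPairs hΓ' hg he, by simpa using he0⟩

/-- With d pairs left there are 2^{2d} - 1 images for the first vector and 2 · 2^{2(d-1)} for the
second. `Γ` may be any group of isometries containing all transvections, so the count applies
directly to the reduction of Sp(2s, ℤ), without a prior proof that reduction is surjective. -/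
theorem card_eq_prod (hp : IsHyperbolic ω e f s) (hs : ∀ v ∈ pairPerp ω e f s, v = 0)
    (hΓ' : Γ ≤ isometries ω) (hΓ : ∀ v, transv ω hp.isAlt v 1 ∈ Γ) :
    Nat.card Γ = ∏ k ∈ Finset.Icc 1 s, ((2 ^ (2 * k) - 1) * 2 ^ (2 * k - 1)) := by
  have h1 : ∀ d m, m + d = s → (pairPerp ω e f m).ncard = 2 ^ (2 * d) := fun d => by
    induction d with
    | zero =>
      rintro m rfl
      rw [add_zero] at hs
      rw [(Set.eq_singleton_iff_unique_mem (a := (0 : V))).mpr ⟨fun i _ => by simp, hs⟩]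
      simp
    | succ d ih =>
      intro m hm
      rw [hp.ncard_pairPerp (by omega), ih (m + 1) (by omega)]
      ring
  have h2 : ∀ d m, m + d = s → Nat.card (fixPairs Γ e f m) =
      ∏ k ∈ Finset.Icc 1 d, ((2 ^ (2 * k) - 1) * 2 ^ (2 * k - 1)) := fun d => by
    induction d with
    | zero =>
      rintro m rfl
      rw [add_zero] at hs
      have : fixPairs Γ e f m = ⊥ := by
        rw [Subgroup.eq_bot_iff_forall]
        intro g hg
        ext v
        refine sub_eq_zero.mp (hs _ fun i hi => ?_)
        have e1 := hΓ' hg.1 v (e i)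
        have e2 := hΓ' hg.1 v (f i)
        rw [(hg.2 i hi).1] at e1
        rw [(hg.2 i hi).2] at e2
        simp [e1, e2]
      simp [this]
    | succ d ih =>
      intro m hm
      rw [hp.card_fixPairs_eq hs hΓ' hΓ (by omega), ih (m + 1) (by omega),
        Set.ncard_sdiff_singleton_of_mem (fun i _ => by simp), h1 (d + 1) m hm,
        hp.ncard_pairPerp_one (by omega), h1 d (m + 1) (by omega),
        Finset.prod_Icc_succ_top (by omega), show 2 * (d + 1) - 1 = 2 * d + 1 by omega, pow_succ]
      ring
  rw [← h2 s 0 (zero_add s)]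
  congr 1
  have : fixPairs Γ e f 0 = Γ := by
    ext g
    exact ⟨fun h => h.1, fun h => ⟨h, fun i hi => by omega⟩⟩
  rw [this]

end IsHyperbolic

end

/-! ### Matrices as linear automorphisms -/

section

variable {ι : Type} [Fintype ι] [DecidableEq ι]

/-- Invertible matrices as linear automorphisms of the module of column vectors. -/
def glEquiv (R : Type) [CommRing R] (ι : Type) [Fintype ι] [DecidableEq ι] :
    GL ι R ≃* ((ι → R) ≃ₗ[R] (ι → R)) :=
  Matrix.GeneralLinearGroup.toLin.trans (LinearMap.GeneralLinearGroup.generalLinearEquiv R (ι → R))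

theorem glEquiv_apply {R : Type} [CommRing R] (A : GL ι R) (v : ι → R) :
    glEquiv R ι A v = (A : Matrix ι ι R) *ᵥ v := rfl

theorem glEquiv_mod2_apply (A : GL ι ℤ) (v : ι → ℤ) (i : ι) :
    glEquiv (ZMod 2) ι (mod2 ι A) (fun j => (v j : ZMod 2)) i = (glEquiv ℤ ι A v i : ZMod 2) := by
  simp only [glEquiv_apply, mulVec, dotProduct, Int.cast_sum, Int.cast_mul]
  rfl

theorem glEquiv_rhoMatrix {n : ℕ} (c : (Fin n → ℤ) ≃ₗ[ℤ] (ι → ℤ)) (b : BraidGroup n)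
    (v : ι → ℤ) : glEquiv ℤ ι (rhoMatrix c b) v = c (rho n b (c.symm v)) := by
  change LinearMap.GeneralLinearGroup.generalLinearEquiv ℤ (ι → ℤ)
    (Matrix.GeneralLinearGroup.toLin (Matrix.GeneralLinearGroup.toLin.symm _)) v = _
  rw [MulEquiv.apply_symm_apply]
  rfl

theorem exists_lift_zmod2 (v : ι → ZMod 2) : ∃ w : ι → ℤ, v = fun i => (w i : ZMod 2) :=
  ⟨fun i => (v i).val, by ext i; simp⟩

theorem exists_add_two_smul_iff (v w : ι → ℤ) :
    (∃ x, w = v + (2 : ℤ) • x) ↔ ∀ i, (w i : ZMod 2) = v i := by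
  constructor
  · rintro ⟨x, rfl⟩ i
    have : (2 : ZMod 2) = 0 := rfl
    simp [this]
  · intro h
    have h' : ∀ i, ∃ x, w i = v i + 2 * x := fun i => by
      obtain ⟨x, hx⟩ := (ZMod.intCast_eq_intCast_iff_dvd_sub _ _ 2).mp (h i).symm
      exact ⟨x, by push_cast at hx; linarith⟩
    choose x hx using h'
    exact ⟨x, funext hx⟩

theorem mod2_eq_one_iff (A : GL ι ℤ) :
    mod2 ι A = 1 ↔ ∀ v, ∃ w, glEquiv ℤ ι A v = v + (2 : ℤ) • w := by
  simp only [exists_add_two_smul_iff]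
  constructor
  · intro h v i
    rw [← glEquiv_mod2_apply, h, map_one]
    rfl
  · intro h
    apply (glEquiv (ZMod 2) ι).injective
    rw [map_one]
    apply LinearEquiv.ext
    intro v
    obtain ⟨w, rfl⟩ := exists_lift_zmod2 v
    funext i
    rw [glEquiv_mod2_apply, h]
    rfl

/-- An integral change of coordinates does not affect triviality modulo 2, so the original entries
k_j can be used. -/
theorem mod2_rhoMatrix_eq_one_iff {n : ℕ} (c : (Fin n → ℤ) ≃ₗ[ℤ] (ι → ℤ)) (b : BraidGroup n) :
    mod2 ι (rhoMatrix c b) = 1 ↔ ∀ k j, (rho n b k j : ZMod 2) = k j := by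
  simp only [mod2_eq_one_iff, glEquiv_rhoMatrix, ← exists_add_two_smul_iff]
  constructor
  · intro h k
    obtain ⟨w, hw⟩ := h (c k)
    exact ⟨c.symm w, c.injective (by
      rw [map_add, map_smul, c.apply_symm_apply, ← hw, c.symm_apply_apply])⟩
  · intro h v
    obtain ⟨w, hw⟩ := h (c.symm v)
    exact ⟨c w, by rw [hw, map_add, map_smul, c.apply_symm_apply]⟩

end

/-! ### The reduction modulo 2 and the symmetric group -/

theorem swap_braid {α : Type*} [DecidableEq α] {a b c : α} (hab : a ≠ b) (hbc : b ≠ c)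
    (hac : a ≠ c) : Equiv.swap a b * Equiv.swap b c * Equiv.swap a b =
      Equiv.swap b c * Equiv.swap a b * Equiv.swap b c := by
  rw [Equiv.swap_mul_swap_mul_swap hab hac, Equiv.swap_comm a b, Equiv.swap_comm b c,
    Equiv.swap_mul_swap_mul_swap hbc.symm hac.symm, Equiv.swap_comm]

/-- The permutation of the strands of a braid. -/
def braidPerm (n : ℕ) : BraidGroup n →* Equiv.Perm (Fin (n + 1)) :=
  PresentedGroup.toGroup (f := fun i => Equiv.swap i.castSucc i.succ) (by
    rintro r (⟨i, j, h⟩ | ⟨i, j, h⟩)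
    · simp only [map_mul, map_inv, FreeGroup.lift_apply_of]
      have hij : j.castSucc = i.succ := Fin.ext h.symm
      rw [hij, mul_inv_eq_one]
      refine swap_braid ?_ ?_ ?_ <;> simp only [ne_eq, Fin.ext_iff, Fin.val_castSucc, Fin.val_succ] <;>
        omega
    · simp only [map_mul, map_inv, FreeGroup.lift_apply_of]
      rw [mul_inv_eq_one]
      refine (Equiv.Perm.Disjoint.commute ?_).eq
      rw [Equiv.Perm.disjoint_iff_disjoint_support, Equiv.Perm.support_swap (by simp [Fin.ext_iff]),
        Equiv.Perm.support_swap (by simp [Fin.ext_iff])]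
      simp only [Finset.disjoint_insert_left, Finset.disjoint_singleton_left, Finset.mem_insert,
        Finset.mem_singleton, Fin.ext_iff, Fin.val_castSucc, Fin.val_succ]
      omega)

theorem braidPerm_of {n : ℕ} (i : Fin n) :
    braidPerm n (PresentedGroup.of i) = Equiv.swap i.castSucc i.succ :=
  PresentedGroup.toGroup.of _

theorem rho_of {n : ℕ} (i : Fin n) : rho n (PresentedGroup.of i) = sigma i :=
  PresentedGroup.toGroup.of _

theorem braidPerm_surjective (n : ℕ) : Function.Surjective (braidPerm n) := by
  rw [← MonoidHom.range_eq_top]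
  refine top_unique ?_
  rw [← Subgroup.closure_eq_top_of_mclosure_eq_top (Equiv.Perm.mclosure_swap_castSucc_succ n),
    Subgroup.closure_le]
  rintro _ ⟨i, rfl⟩
  exact ⟨_, braidPerm_of i⟩

/-- The integer vector `k` is congruent modulo 2 to the differences of `w` from its first entry. -/
def IsDiff {n : ℕ} (k : Fin n → ℤ) (w : Fin (n + 1) → ZMod 2) : Prop :=
  ∀ j, (k j : ZMod 2) = w j.succ + w 0

/-- Modulo 2, σ_1 moves the base point of the differences from strand 0 to strand 1, and σ_i with i
> 1 exchanges k_{i-1} and k_i. -/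
theorem isDiff_sigma {n : ℕ} (i : Fin n) {k : Fin n → ℤ} {w : Fin (n + 1) → ZMod 2}
    (h : IsDiff k w) : IsDiff (sigma i k) (w ∘ Equiv.swap i.castSucc i.succ) := by
  intro j
  have two : (2 : ZMod 2) = 0 := rfl
  have hi := h i
  have hj := h j
  have h00 := CharTwo.add_self_eq_zero (w 0)
  rw [sigma_apply, Function.comp_apply, Function.comp_apply, sigmaFun]
  by_cases h0 : (i : ℕ) = 0
  · have hc : i.castSucc = 0 := Fin.ext h0
    rw [if_pos h0, hc, Equiv.swap_apply_left]
    split_ifs with hji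
    · rw [hji, Equiv.swap_apply_right, hi, add_comm]
    · rw [Equiv.swap_apply_of_ne_of_ne (Fin.succ_ne_zero j) (fun h => hji (Fin.succ_injective _ h)),
        Int.cast_add, hi, hj]
      linear_combination h00
  · have hs0 : Equiv.swap i.castSucc i.succ 0 = 0 :=
      Equiv.swap_apply_of_ne_of_ne (fun h => h0 (congrArg Fin.val h).symm) (Fin.succ_ne_zero i).symm
    rw [if_neg h0, hs0]
    split_ifs with h1 h2
    · have hk := h ⟨i - 1, by omega⟩
      have hc : (⟨i - 1, by omega⟩ : Fin n).succ = i.castSucc :=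
        Fin.ext (by simp only [Fin.val_succ, Fin.val_castSucc]; omega)
      rw [h1, Equiv.swap_apply_right, ← hc, hk]
    · have hc : j.succ = i.castSucc := Fin.ext h2
      rw [hc, Equiv.swap_apply_left]
      push_cast
      rw [hi, two, zero_mul, zero_sub, ZMod.neg_eq_self_mod_two]
    · rw [Equiv.swap_apply_of_ne_of_ne (fun h => h2 (congrArg Fin.val h))
        (fun h => h1 (Fin.succ_injective _ h)), hj]

theorem IsDiff.eq_of_eq {n : ℕ} {k l : Fin n → ℤ} {w : Fin (n + 1) → ZMod 2}
    (h : IsDiff k w) (h' : IsDiff l w) (j : Fin n) : (k j : ZMod 2) = l j := by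
  rw [h j, h' j]

theorem isDiff_rho {n : ℕ} (b : BraidGroup n) (k : Fin n → ℤ) (w : Fin (n + 1) → ZMod 2)
    (h : IsDiff k w) : IsDiff (rho n b k) (w ∘ ⇑(braidPerm n b)⁻¹) := by
  have hb : b ∈ Subgroup.closure (Set.range (PresentedGroup.of : Fin n → BraidGroup n)) := by
    rw [PresentedGroup.closure_range_of]; trivial
  induction hb using Subgroup.closure_induction generalizing k w with
  | mem x hx =>
    obtain ⟨i, rfl⟩ := hx
    rw [rho_of, braidPerm_of, Equiv.swap_inv]
    exact isDiff_sigma i h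
  | one => simpa using h
  | mul x y _ _ hx hy =>
    rw [map_mul, map_mul, _root_.mul_inv_rev]
    exact hx _ _ (hy _ _ h)
  | inv x _ hx =>
    rw [map_inv, map_inv, inv_inv]
    -- The inverse image of `k` is lifted with base value 0 and carried forward by `x`. The
    -- differences determine `w` only up to a constant, so `h3` compares differences.
    have h' : IsDiff ((rho n x)⁻¹ k) (Fin.cons 0 fun j => (((rho n x)⁻¹ k j : ℤ) : ZMod 2)) :=
      fun j => by simp
    have h2 := hx _ _ h'
    rw [← LinearEquiv.mul_apply, mul_inv_cancel] at h2
    set w' : Fin (n + 1) → ZMod 2 := Fin.cons 0 fun j => (((rho n x)⁻¹ k j : ℤ) : ZMod 2)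
    have h3 : ∀ a, w a + w 0 = w' ((braidPerm n x)⁻¹ a) + w' ((braidPerm n x)⁻¹ 0) := fun a => by
      cases a using Fin.cases with
      | zero => simp [CharTwo.add_self_eq_zero]
      | succ j => rw [← h j]; exact h2 j
    intro j
    rw [h' j]
    have e1 := h3 (braidPerm n x j.succ)
    have e2 := h3 (braidPerm n x 0)
    rw [← Equiv.Perm.mul_apply, inv_mul_cancel, Equiv.Perm.one_apply] at e1 e2
    simp only [Function.comp_apply]
    grind

/-- If the action is trivial modulo 2, the permutation changes every `w` at most by a constant.
Testing on the indicator of a moved point `a` gives a contradiction: the change is 1 at `a`, but 0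
at any strand other than `a` and its image. Such a third strand exists because n ≥ 2. -/
theorem mod2_rhoMatrix_eq_one_iff_braidPerm {n : ℕ} (hn : 2 ≤ n) {ι : Type} [Fintype ι]
    [DecidableEq ι] (c : (Fin n → ℤ) ≃ₗ[ℤ] (ι → ℤ)) (b : BraidGroup n) :
    mod2 ι (rhoMatrix c b) = 1 ↔ braidPerm n b = 1 := by
  rw [mod2_rhoMatrix_eq_one_iff]
  constructor
  · intro h
    by_contra hb
    obtain ⟨a, ha⟩ : ∃ a, braidPerm n b a ≠ a := by
      by_contra! h; exact hb (Equiv.ext h)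
    let w : Fin (n + 1) → ℤ := Pi.single a 1
    have h1 : IsDiff (fun j : Fin n => w j.succ + w 0) (fun j => (w j : ZMod 2)) := fun j => by simp
    have h2 := isDiff_rho b _ _ h1
    have h3 : ∀ x, ((w x : ℤ) : ZMod 2) + w ((braidPerm n b)⁻¹ x) =
        w 0 + w ((braidPerm n b)⁻¹ 0) := fun x => by
      cases x using Fin.cases with
      | zero => rfl
      | succ j =>
        have e1 := h2 j
        rw [h] at e1
        have e2 := h1 j
        rw [e1] at e2
        simp only [Function.comp_apply] at e2
        grind
    obtain ⟨x, hx⟩ : ∃ x, x ∉ ({a, braidPerm n b a} : Finset (Fin (n + 1))) := by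
      by_contra! h
      have h4 := Finset.card_le_card (fun x _ => h x : Finset.univ ⊆ _)
      have h5 := Finset.card_le_two (a := a) (b := braidPerm n b a)
      rw [Finset.card_univ, Fintype.card_fin] at h4
      omega
    have h4 := (h3 x).trans (h3 a).symm
    have e1 : (braidPerm n b)⁻¹ a ≠ a := fun h => ha (by rw [Equiv.Perm.inv_eq_iff_eq] at h; exact h.symm)
    have e2 : (braidPerm n b)⁻¹ x ≠ a := fun h => hx (by
      rw [Equiv.Perm.inv_eq_iff_eq] at h; simp [h])
    have e3 : x ≠ a := fun h => hx (by simp [h])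
    simp only [w, Pi.single_apply, e1, e2, e3, if_true, if_false] at h4
    exact absurd h4 (by decide)
  · intro h k j
    have h1 : IsDiff k (Fin.cons 0 fun j => (k j : ZMod 2)) := fun j => by simp
    have h2 := isDiff_rho b _ _ h1
    rw [h] at h2
    exact IsDiff.eq_of_eq h2 h1 j

theorem exists_mulEquiv_of_ker_eq {B G P : Type*} [Group B] [Group G] [Group P] (f : B →* G)
    (p : B →* P) (hp : Function.Surjective p) (h : ∀ b, f b = 1 ↔ p b = 1) :
    ∃ e : f.range ≃* P, ∀ b, e ⟨f b, b, rfl⟩ = p b := by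
  have hk : f.rangeRestrict.ker = p.ker := by
    ext b
    rw [MonoidHom.ker_rangeRestrict, MonoidHom.mem_ker, MonoidHom.mem_ker, h]
  let e := (QuotientGroup.quotientKerEquivOfSurjective f.rangeRestrict
    f.rangeRestrict_surjective).symm.trans
      ((QuotientGroup.quotientMulEquivOfEq hk).trans (QuotientGroup.quotientKerEquivOfSurjective p hp))
  refine ⟨e, fun b => ?_⟩
  have : (QuotientGroup.quotientKerEquivOfSurjective f.rangeRestrict
      f.rangeRestrict_surjective).symm ⟨f b, b, rfl⟩ = (b : B ⧸ f.rangeRestrict.ker) := by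
    rw [MulEquiv.symm_apply_eq]
    rfl
  simp only [e, MulEquiv.trans_apply, this]
  rfl

/-! ### The standard symplectic form -/

/-- The symplectic form `∑ (q_i p_i' - p_i q_i')`. -/
def omega (R : Type) [CommRing R] (s : ℕ) : LinearMap.BilinForm R (Fin s ⊕ Fin s → R) :=
  Matrix.toBilin' (-J (Fin s) R)

section

variable {R : Type} [CommRing R] {s : ℕ}

theorem omega_apply (x y : Fin s ⊕ Fin s → R) :
    omega R s x y = ∑ i, (x (Sum.inl i) * y (Sum.inr i) - x (Sum.inr i) * y (Sum.inl i)) := by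
  rw [omega, Matrix.toBilin'_apply', neg_mulVec, J, fromBlocks_mulVec, dotProduct_neg]
  simp only [dotProduct, Fintype.sum_sum_type, Finset.sum_sub_distrib, Sum.elim_inl, Sum.elim_inr]
  simp [neg_mulVec, dotProduct]
  ring

theorem omega_isAlt : (omega R s).IsAlt := fun x => by
  rw [omega_apply]
  exact Finset.sum_eq_zero fun i _ => by ring

theorem mem_symplecticGroup_iff (A : GL (Fin s ⊕ Fin s) R) :
    (A : Matrix (Fin s ⊕ Fin s) (Fin s ⊕ Fin s) R) ∈ symplecticGroup (Fin s) R ↔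
      glEquiv R _ A ∈ isometries (omega R s) := by
  rw [SymplecticGroup.mem_iff', mem_isometries]
  have key : ∀ x y, omega R s (glEquiv R _ A x) (glEquiv R _ A y) =
      Matrix.toBilin' ((A : Matrix (Fin s ⊕ Fin s) (Fin s ⊕ Fin s) R)ᵀ * (-J (Fin s) R) *
        (A : Matrix (Fin s ⊕ Fin s) (Fin s ⊕ Fin s) R)) x y := by
    intro x y
    rw [omega, Matrix.toBilin'_apply', Matrix.toBilin'_apply', glEquiv_apply, glEquiv_apply,
      ← mulVec_mulVec, ← mulVec_mulVec, dotProduct_mulVec x, vecMul_transpose]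
  simp only [key]
  constructor
  · intro h x y
    rw [mul_neg, neg_mul, h, omega]
  · intro h
    have h2 : Matrix.toBilin' ((A : Matrix (Fin s ⊕ Fin s) (Fin s ⊕ Fin s) R)ᵀ * (-J (Fin s) R) *
        (A : Matrix (Fin s ⊕ Fin s) (Fin s ⊕ Fin s) R))
        = Matrix.toBilin' (-J (Fin s) R) := by
      refine LinearMap.ext fun x => LinearMap.ext fun y => h x y
    have h3 := Matrix.toBilin'.injective h2
    rwa [mul_neg, neg_mul, neg_inj] at h3

theorem mem_Sp_iff (A : GL (Fin s ⊕ Fin s) ℤ) : A ∈ Sp s ↔ glEquiv ℤ _ A ∈ isometries (omega ℤ s) :=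
  mem_symplecticGroup_iff A

/-- The basis vector with coordinate `q_{t+1} = 1`; zero for `t ≥ s`. -/
def qVec (R : Type) [CommRing R] (s t : ℕ) : Fin s ⊕ Fin s → R :=
  Sum.elim (fun j => if (j : ℕ) = t then 1 else 0) 0

/-- The basis vector with coordinate `p_{t+1} = 1`; zero for `t ≥ s`. -/
def pVec (R : Type) [CommRing R] (s t : ℕ) : Fin s ⊕ Fin s → R :=
  Sum.elim 0 (fun j => if (j : ℕ) = t then 1 else 0)

theorem omega_qVec (v : Fin s ⊕ Fin s → R) (t : Fin s) :
    omega R s v (qVec R s t) = -v (Sum.inr t) := by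
  simp [omega_apply, qVec, Fin.val_inj]

theorem omega_pVec (v : Fin s ⊕ Fin s → R) (t : Fin s) :
    omega R s v (pVec R s t) = v (Sum.inl t) := by
  simp [omega_apply, pVec, Fin.val_inj]

theorem isHyperbolic_qVec_pVec : IsHyperbolic (omega R s) (qVec R s) (pVec R s) s where
  isAlt := omega_isAlt
  ef i hi j hj := by
    rw [omega_pVec _ ⟨j, hj⟩]
    simp [qVec, eq_comm]
  ee i hi j hj := by
    rw [omega_qVec _ ⟨j, hj⟩]
    simp [qVec]
  ff i hi j hj := by
    rw [omega_pVec _ ⟨j, hj⟩]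
    simp [pVec]

end

theorem eq_top_of_qVec_pVec_mem {s : ℕ} (S : AddSubgroup (Fin s ⊕ Fin s → ℤ))
    (hq : ∀ t < s, qVec ℤ s t ∈ S) (hp : ∀ t < s, pVec ℤ s t ∈ S) : S = ⊤ := by
  refine top_unique fun v _ => ?_
  have : v = ∑ t : Fin s, (v (Sum.inl t) • qVec ℤ s t + v (Sum.inr t) • pVec ℤ s t) := by
    funext i
    rcases i with i | i <;> simp [qVec, pVec, Finset.sum_apply, Fin.val_inj]
  rw [this]
  exact sum_mem fun t _ => add_mem (zsmul_mem (hq t t.2) _) (zsmul_mem (hp t t.2) _)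

/-! ### The chain of vectors of the braid representation -/

/-- The vectors along which the generators of the braid group act as transvections. -/
def chainVec (s i : ℕ) : Fin s ⊕ Fin s → ℤ :=
  Sum.elim (fun j => if i = 2 * (j : ℕ) + 1 then 1 else if i = 2 * (j : ℕ) + 3 then -1 else 0)
    (fun j => if i = 0 then -1 else if i = 2 * (j : ℕ) + 2 then 1 else 0)

section

variable {s : ℕ}

theorem chainVec_even (s t : ℕ) : chainVec s (2 * t + 2) = pVec ℤ s t := by
  funext i
  rcases i with i | i
  · simp only [chainVec, pVec, Sum.elim_inl, Pi.zero_apply]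
    split_ifs <;> omega
  · simp only [chainVec, pVec, Sum.elim_inr]
    split_ifs <;> omega

theorem chainVec_one (s : ℕ) : chainVec s 1 = qVec ℤ s 0 := by
  funext i
  rcases i with i | i
  · simp only [chainVec, qVec, Sum.elim_inl, Pi.zero_apply]
    split_ifs <;> omega
  · simp only [chainVec, qVec, Sum.elim_inr, Pi.zero_apply]
    split_ifs <;> omega

theorem chainVec_odd (s t : ℕ) : chainVec s (2 * t + 3) = qVec ℤ s (t + 1) - qVec ℤ s t := by
  funext i
  rcases i with i | i
  · simp only [chainVec, qVec, Sum.elim_inl, Pi.sub_apply]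
    split_ifs <;> omega
  · simp [chainVec, qVec]
    omega

theorem omega_chainVec_zero (v : Fin s ⊕ Fin s → ℤ) :
    omega ℤ s v (chainVec s 0) = -∑ i, v (Sum.inl i) := by
  simp [omega_apply, chainVec]

theorem isChain_chainVec (s : ℕ) : IsChain (omega ℤ s) (chainVec s) (2 * s + 1) := by
  have key : ∀ i j, i < j → j < 2 * s + 1 →
      omega ℤ s (chainVec s i) (chainVec s j) = if i + 1 = j then 1 else 0 := by
    intro i j hij hj
    obtain ⟨t, rfl | rfl⟩ : ∃ t, j = 2 * t + 1 ∨ j = 2 * t + 2 := ⟨(j - 1) / 2, by omega⟩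
    · rcases t with _ | t
      · rw [mul_zero, zero_add, chainVec_one, show qVec ℤ s 0 = qVec ℤ s (⟨0, by omega⟩ : Fin s) from rfl, omega_qVec]
        simp only [chainVec, Sum.elim_inr]
        split_ifs <;> omega
      · rw [show 2 * (t + 1) + 1 = 2 * t + 3 by ring, chainVec_odd, map_sub,
          omega_qVec _ ⟨t + 1, by omega⟩, omega_qVec _ ⟨t, by omega⟩]
        simp only [chainVec, Sum.elim_inr]
        split_ifs <;> omega
    · rw [chainVec_even, omega_pVec _ ⟨t, by omega⟩]
      simp only [chainVec, Sum.elim_inl]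
      split_ifs <;> omega
  refine ⟨omega_isAlt, fun i hi => ?_, fun i j hij hj => ?_⟩
  · rw [key i _ (Nat.lt_succ_self i) hi, if_pos rfl]
  · rw [key i j (by omega) hj, if_neg (by omega)]

theorem chainE_chainVec (s m : ℕ) :
    chainE (chainVec s) m = Sum.elim (0 : Fin s → ℤ) (fun j : Fin s => if (j : ℕ) < m then 0 else -1) := by
  induction m with
  | zero =>
    funext i
    rcases i with i | i <;> simp [chainE, chainVec]
  | succ m ih =>
    rw [chainE_succ, ih, chainVec_even]
    funext i
    rcases i with i | i
    · simp [pVec]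
    · simp only [pVec, Pi.add_apply, Sum.elim_inr]
      split_ifs <;> omega

/-- The 2s + 1 chain vectors satisfy one relation: the members of even index sum to zero. -/
theorem chainVec_last (hs : 1 ≤ s) : chainVec s (2 * s) = -chainE (chainVec s) (s - 1) := by
  rw [chainE_chainVec]
  funext i
  rcases i with i | i
  · simp only [chainVec, Sum.elim_inl, Pi.neg_apply, Pi.zero_apply]
    split_ifs <;> omega
  · simp only [chainVec, Sum.elim_inr, Pi.neg_apply]
    split_ifs <;> omega

theorem eq_top_of_chainVec_mem (S : AddSubgroup (Fin s ⊕ Fin s → ℤ))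
    (h : ∀ i < 2 * s, chainVec s i ∈ S) : S = ⊤ := by
  refine eq_top_of_qVec_pVec_mem S (fun t => ?_) fun t ht => ?_
  · induction t with
    | zero => exact fun ht => by rw [← chainVec_one]; exact h 1 (by omega)
    | succ t ih =>
      intro ht
      have := add_mem (h (2 * t + 3) (by omega)) (ih (by omega))
      rwa [chainVec_odd, sub_add_cancel] at this
  · rw [← chainVec_even]
    rcases Nat.lt_or_ge (2 * t + 2) (2 * s) with h' | h'
    -- The last basis vector p_s is a_{2s}, which is outside the given range; it is recovered below
    -- from the relation among the even members.
    · exact h _ h'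
    · rw [show 2 * t + 2 = 2 * s by omega, chainVec_last (by omega)]
      exact neg_mem (sum_mem fun k hk => h _ (by have := Finset.mem_range.mp hk; omega))

end

/-! ### The generators in the canonical coordinates -/

theorem xCoords_symm_apply {n : ℕ} (x : Fin n → ℤ) (i : Fin n) :
    (xCoords n).symm x i = (if (i : ℕ) = 0 then 0 else ext0 x (i - 1)) + x i := rfl

/-- Checked after applying the inverse k_i = x_{i-1} + x_i, which involves only neighbours and so
avoids alternating sums. -/
theorem xCoords_sigma {n : ℕ} (i : Fin n) (k : Fin n → ℤ) (j : Fin n) :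
    xCoords n (sigma i k) j = xCoords n k j +
      if (i : ℕ) = 0 then (if (j : ℕ) % 2 = 1 then ext0 (xCoords n k) 0 else 0)
      else if (j : ℕ) + 1 = i then (if (j : ℕ) = 0 then 0 else ext0 (xCoords n k) (j - 1)) -
        ext0 (xCoords n k) (j + 1) else 0 := by
  obtain ⟨x, rfl⟩ := (xCoords n).symm.surjective k
  rw [LinearEquiv.apply_symm_apply]
  revert j
  rw [← funext_iff (g := fun j => x j + _), ← LinearEquiv.eq_symm_apply]
  funext j
  rw [sigma_apply, sigmaFun]
  simp only [xCoords_symm_apply, ext0]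
  grind

theorem ext0_xCoords_sigma {n : ℕ} (i : Fin n) (k : Fin n → ℤ) (j : ℕ) :
    ext0 (xCoords n (sigma i k)) j = ext0 (xCoords n k) j +
      if (i : ℕ) = 0 then (if j % 2 = 1 ∧ j < n then ext0 (xCoords n k) 0 else 0)
      else if j + 1 = i then (if j = 0 then 0 else ext0 (xCoords n k) (j - 1)) -
        ext0 (xCoords n k) (j + 1) else 0 := by
  by_cases hj : j < n
  · have h : ∀ x : Fin n → ℤ, ext0 x j = x ⟨j, hj⟩ := fun x => ext0_val x ⟨j, hj⟩
    simp only [h, xCoords_sigma, hj, and_true]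
  · have h : ∀ x : Fin n → ℤ, ext0 x j = 0 := fun x => dif_neg hj
    have h1 : ¬ j + 1 = i := by omega
    simp [h, hj, h1]

/-- The coordinates `q_i = X_{2i-1} - X_{2i+1}`, `p_i = X_{2i}` of a sequence `X`. -/
def qpFun (s : ℕ) (X : ℕ → ℤ) : Fin s ⊕ Fin s → ℤ :=
  Sum.elim (fun t => X (2 * t) - X (2 * t + 2)) (fun t => X (2 * t + 1))

/-- Stated for a sequence vanishing at index `2 * s` so that both parities can use it: for n = 2s
this is the convention x_{2s+1} = 0, for n = 2s + 1 the last coordinate is replaced by zero. -/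
theorem qpFun_eq {s i : ℕ} {X X' : ℕ → ℤ} (hi : i < 2 * s) (hX : X (2 * s) = 0)
    (hX' : ∀ j, j ≤ 2 * s → X' j = X j + if i = 0 then (if j % 2 = 1 then X 0 else 0)
      else if j + 1 = i then (if j = 0 then 0 else X (j - 1)) - X (j + 1) else 0) :
    qpFun s X' = qpFun s X + omega ℤ s (qpFun s X) (chainVec s i) • chainVec s i := by
  obtain rfl | ⟨t, rfl⟩ | ⟨t, rfl⟩ | rfl : i = 0 ∨ (∃ t, i = 2 * t + 3) ∨ (∃ t, i = 2 * t + 2) ∨ i = 1 := by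
    rcases i.even_or_odd' with ⟨t, rfl | rfl⟩
    · rcases t with _ | t
      · exact Or.inl rfl
      · exact Or.inr (Or.inr (Or.inl ⟨t, rfl⟩))
    · rcases t with _ | t
      · exact Or.inr (Or.inr (Or.inr rfl))
      · exact Or.inr (Or.inl ⟨t, by ring⟩)
  · have h : omega ℤ s (qpFun s X) (chainVec s 0) = -X 0 := by
      rw [omega_chainVec_zero]
      simp only [qpFun, Sum.elim_inl]
      rw [Finset.sum_range (n := s) (f := fun t => X (2 * t) - X (2 * t + 2)) |>.symm]
      have := Finset.sum_range_sub' (fun t => X (2 * t)) s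
      simp only [mul_add_one, hX, mul_zero, sub_zero] at this
      rw [this]
    rw [h]
    funext a
    rcases a with a | a
    · have := a.2
      have e1 : 2 * (a : ℕ) % 2 ≠ 1 := by omega
      have e2 : (2 * (a : ℕ) + 2) % 2 ≠ 1 := by omega
      simp [qpFun, chainVec, hX' (2 * a) (by omega), hX' (2 * a + 2) (by omega), e1, e2]
    · have e1 : (2 * (a : ℕ) + 1) % 2 = 1 := by omega
      simp [qpFun, chainVec, hX' (2 * a + 1) (by omega), e1]
  · have h : omega ℤ s (qpFun s X) (chainVec s (2 * t + 3)) = X (2 * t + 1) - X (2 * t + 3) := by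
      rw [chainVec_odd, map_sub, omega_qVec _ ⟨t + 1, by omega⟩, omega_qVec _ ⟨t, by omega⟩]
      simp [qpFun, mul_add]
      ring
    rw [h]
    funext a
    rcases a with a | a
    · simp only [qpFun, chainVec, Sum.elim_inl, Pi.add_apply, Pi.smul_apply, smul_eq_mul,
        hX' (2 * a) (by omega), hX' (2 * a + 2) (by omega)]
      grind
    · simp only [qpFun, chainVec, Sum.elim_inr, Pi.add_apply, Pi.smul_apply, smul_eq_mul,
        hX' (2 * a + 1) (by omega)]
      grind
  · have h : omega ℤ s (qpFun s X) (chainVec s (2 * t + 2)) = X (2 * t) - X (2 * t + 2) := by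
      rw [chainVec_even, omega_pVec _ ⟨t, by omega⟩]
      simp [qpFun]
    rw [h]
    funext a
    rcases a with a | a
    · simp only [qpFun, chainVec, Sum.elim_inl, Pi.add_apply, Pi.smul_apply, smul_eq_mul,
        hX' (2 * a) (by omega), hX' (2 * a + 2) (by omega)]
      grind
    · simp only [qpFun, chainVec, Sum.elim_inr, Pi.add_apply, Pi.smul_apply, smul_eq_mul,
        hX' (2 * a + 1) (by omega)]
      grind
  · have h : omega ℤ s (qpFun s X) (chainVec s 1) = - X 1 := by
      rw [chainVec_one, show qVec ℤ s 0 = qVec ℤ s (⟨0, by omega⟩ : Fin s) from rfl, omega_qVec]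
      simp [qpFun]
    rw [h]
    funext a
    rcases a with a | a
    · simp only [qpFun, chainVec, Sum.elim_inl, Pi.add_apply, Pi.smul_apply, smul_eq_mul,
        hX' (2 * a) (by omega), hX' (2 * a + 2) (by omega)]
      grind
    · simp only [qpFun, chainVec, Sum.elim_inr, Pi.add_apply, Pi.smul_apply, smul_eq_mul,
        hX' (2 * a + 1) (by omega)]
      grind

theorem glEquiv_rhoEven_of {s : ℕ} (i : Fin (2 * s)) :
    glEquiv ℤ _ (rhoEven s (PresentedGroup.of i)) =
      transv (omega ℤ s) omega_isAlt (chainVec s i) 1 := by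
  apply LinearEquiv.ext
  intro v
  rw [rhoEven, glEquiv_rhoMatrix, rho_of, transv_apply, one_mul]
  obtain ⟨k, rfl⟩ := ((xCoords (2 * s)).trans (qpEven s)).surjective v
  rw [LinearEquiv.symm_apply_apply]
  refine qpFun_eq (X := ext0 (xCoords (2 * s) k)) i.2 (dif_neg (lt_irrefl _)) fun j hj => ?_
  change ext0 (xCoords (2 * s) (sigma i k)) j = _
  rw [ext0_xCoords_sigma]
  have : j % 2 = 1 ∧ j < 2 * s ↔ j % 2 = 1 := by omega
  simp only [this]

/-! ### Affine transformations -/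

section Affine

variable {R : Type} [CommRing R] {ι : Type}

/-- The linear automorphism of `R^ι × R` which restricts to `v ↦ T v + y` on the affine hyperplane
where the last coordinate is `1`. -/
def affineEquiv (T : (ι → R) ≃ₗ[R] (ι → R)) (y : ι → R) : (ι ⊕ Unit → R) ≃ₗ[R] (ι ⊕ Unit → R) where
  toFun v := Sum.elim (T (v ∘ Sum.inl) + v (Sum.inr ()) • y) (fun _ => v (Sum.inr ()))
  invFun v := Sum.elim (T.symm (v ∘ Sum.inl - v (Sum.inr ()) • y)) (fun _ => v (Sum.inr ()))
  map_add' v w := by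
    funext i
    rcases i with i | i
    · have : (v + w) ∘ Sum.inl = v ∘ (Sum.inl : ι → ι ⊕ Unit) + w ∘ Sum.inl := rfl
      simp [this]; ring
    · rfl
  map_smul' c v := by
    funext i
    rcases i with i | i
    · have : (c • v) ∘ Sum.inl = c • (v ∘ (Sum.inl : ι → ι ⊕ Unit)) := rfl
      simp [this]; ring
    · rfl
  left_inv v := by
    funext i
    rcases i with i | i <;> simp
  right_inv v := by
    funext i
    rcases i with i | i <;> simp

theorem affineEquiv_apply (T : (ι → R) ≃ₗ[R] (ι → R)) (y : ι → R) (v : ι ⊕ Unit → R) :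
    affineEquiv T y v =
      Sum.elim (T (v ∘ Sum.inl) + v (Sum.inr ()) • y) (fun _ => v (Sum.inr ())) := rfl

theorem affineEquiv_injective : Function.Injective2 (affineEquiv (R := R) (ι := ι)) := by
  intro T T' y y' h
  have hT : T = T' := by
    apply LinearEquiv.ext
    intro v
    have := congrArg (fun g => g (Sum.elim v 0) ∘ Sum.inl) h
    simpa [affineEquiv_apply] using this
  subst hT
  have := congrArg (fun g => g (Sum.elim 0 1) ∘ Sum.inl) h
  refine ⟨rfl, ?_⟩
  simpa [affineEquiv_apply] using this

theorem affineEquiv_mul (T T' : (ι → R) ≃ₗ[R] (ι → R)) (y y' : ι → R) :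
    affineEquiv T y * affineEquiv T' y' = affineEquiv (T * T') (T y' + y) := by
  apply LinearEquiv.ext
  intro v
  funext i
  rcases i with i | i
  · simp [LinearEquiv.mul_apply, affineEquiv_apply]
    ring
  · rfl

end Affine

theorem mem_SpAffine_iff {s : ℕ} (A : GL ((Fin s ⊕ Fin s) ⊕ Unit) ℤ) : A ∈ SpAffine s ↔
    ∃ T ∈ isometries (omega ℤ s), ∃ y, glEquiv ℤ _ A = affineEquiv T y := by
  have key : ∀ (g : GL (Fin s ⊕ Fin s) ℤ) (y : Fin s ⊕ Fin s → ℤ),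
      (A : Matrix ((Fin s ⊕ Fin s) ⊕ Unit) ((Fin s ⊕ Fin s) ⊕ Unit) ℤ) =
        fromBlocks (g : Matrix (Fin s ⊕ Fin s) (Fin s ⊕ Fin s) ℤ) (replicateCol Unit y) 0 1 ↔
      glEquiv ℤ _ A = affineEquiv (glEquiv ℤ _ g) y := by
    intro g y
    have h : ∀ v, affineEquiv (glEquiv ℤ _ g) y v =
        fromBlocks (g : Matrix (Fin s ⊕ Fin s) (Fin s ⊕ Fin s) ℤ) (replicateCol Unit y) 0 1 *ᵥ v := by
      intro v
      rw [affineEquiv_apply, fromBlocks_mulVec, glEquiv_apply]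
      congr 1
      · funext i
        simp [mulVec, dotProduct, mul_comm]
      · funext i
        simp
    constructor
    · intro hA
      apply LinearEquiv.ext
      intro v
      rw [h, glEquiv_apply, hA]
    · intro hA
      apply Matrix.mulVec_injective
      funext v
      rw [← h, ← hA, glEquiv_apply]
  constructor
  · rintro ⟨g, hg, y, h⟩
    exact ⟨_, (mem_Sp_iff g).mp hg, y, (key g y).mp h⟩
  · rintro ⟨T, hT, y, h⟩
    refine ⟨(glEquiv ℤ _).symm T, (mem_Sp_iff _).mpr (by rwa [MulEquiv.apply_symm_apply]), y,
      (key _ y).mpr (by rwa [MulEquiv.apply_symm_apply])⟩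

/-! ### The generators in odd dimension -/

section Odd

variable {s : ℕ}

/-- The projection to the hyperplane of vectors with last coordinate zero, along the common fixed
vector of all generators but the last. -/
def oddProj (s : ℕ) : ((Fin s ⊕ Fin s) ⊕ Unit → ℤ) →ₗ[ℤ] (Fin s ⊕ Fin s → ℤ) where
  toFun v := v ∘ Sum.inl + v (Sum.inr ()) • qVec ℤ s (s - 1)
  map_add' v w := by
    funext i
    simp; ring
  map_smul' c v := by
    funext i
    simp; ring

/-- The embedding of the hyperplane of vectors with last coordinate zero. -/
def oddIncl (s : ℕ) : (Fin s ⊕ Fin s → ℤ) →ₗ[ℤ] ((Fin s ⊕ Fin s) ⊕ Unit → ℤ) where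
  toFun y := Sum.elim y 0
  map_add' v w := by
    funext i
    rcases i with i | i <;> simp
  map_smul' c v := by
    funext i
    rcases i with i | i <;> simp

theorem oddProj_apply (v : (Fin s ⊕ Fin s) ⊕ Unit → ℤ) :
    oddProj s v = v ∘ Sum.inl + v (Sum.inr ()) • qVec ℤ s (s - 1) := rfl

theorem oddIncl_apply (y : Fin s ⊕ Fin s → ℤ) : oddIncl s y = Sum.elim y 0 := rfl

theorem oddProj_oddIncl (y : Fin s ⊕ Fin s → ℤ) : oddProj s (oddIncl s y) = y := by
  simp [oddProj_apply, oddIncl_apply, Function.comp_def]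

theorem ext_oddProj {v w : (Fin s ⊕ Fin s) ⊕ Unit → ℤ} (h : oddProj s v = oddProj s w)
    (h' : v (Sum.inr ()) = w (Sum.inr ())) : v = w := by
  rw [oddProj_apply, oddProj_apply, h', add_left_inj] at h
  funext i
  rcases i with i | i
  · exact congrFun h i
  · exact h'

/-- The pullback of the symplectic form along `oddProj`. -/
def oddForm (s : ℕ) : LinearMap.BilinForm ℤ ((Fin s ⊕ Fin s) ⊕ Unit → ℤ) :=
  (omega ℤ s).compl₁₂ (oddProj s) (oddProj s)

theorem oddForm_apply (v w : (Fin s ⊕ Fin s) ⊕ Unit → ℤ) :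
    oddForm s v w = omega ℤ s (oddProj s v) (oddProj s w) := rfl

theorem oddForm_isAlt : (oddForm s).IsAlt := fun v => omega_isAlt (oddProj s v)

theorem isChain_oddIncl (s : ℕ) :
    IsChain (oddForm s) (fun i => oddIncl s (chainVec s i)) (2 * s) where
  isAlt := oddForm_isAlt
  adj i hi := by
    rw [oddForm_apply, oddProj_oddIncl, oddProj_oddIncl]
    exact (isChain_chainVec s).adj i (by omega)
  orth i j hi hj := by
    rw [oddForm_apply, oddProj_oddIncl, oddProj_oddIncl]
    exact (isChain_chainVec s).orth i j hi (by omega)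

/-- Adding x_{2s+1} to q_s = x_{2s-1} - x_{2s+1} amounts to setting x_{2s+1} to zero. -/
theorem oddProj_qpOdd (x : Fin (2 * s + 1) → ℤ) :
    oddProj s (qpOdd s x) = qpFun s (fun j => if j < 2 * s then ext0 x j else 0) := by
  funext i
  rcases i with i | i
  · have := i.2
    simp only [oddProj_apply, qpOdd, qpFun, qVec, LinearEquiv.coe_mk, LinearMap.coe_mk,
      AddHom.coe_mk, Pi.add_apply, Function.comp_apply, Sum.elim_inl, Sum.elim_inr, Pi.smul_apply,
      smul_eq_mul]
    rw [if_pos (by omega : 2 * (i : ℕ) < 2 * s)]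
    by_cases h : (i : ℕ) = s - 1
    · rw [if_pos h, if_neg (by omega : ¬ 2 * (i : ℕ) + 2 < 2 * s),
        show 2 * (i : ℕ) + 2 = 2 * s by omega]
      ring
    · rw [if_neg h, if_pos (by omega : 2 * (i : ℕ) + 2 < 2 * s)]
      ring
  · have h : 2 * (i : ℕ) + 1 < 2 * s := by omega
    simp [oddProj_apply, qpOdd, qpFun, qVec, h]

theorem glEquiv_rhoOdd_of {i : Fin (2 * s + 1)} (hi : (i : ℕ) < 2 * s) :
    glEquiv ℤ _ (rhoOdd s (PresentedGroup.of i)) =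
      transv (oddForm s) oddForm_isAlt (oddIncl s (chainVec s i)) 1 := by
  apply LinearEquiv.ext
  intro v
  rw [rhoOdd, glEquiv_rhoMatrix, rho_of, transv_apply, one_mul]
  obtain ⟨k, rfl⟩ := ((xCoords (2 * s + 1)).trans (qpOdd s)).surjective v
  rw [LinearEquiv.symm_apply_apply, LinearEquiv.trans_apply, LinearEquiv.trans_apply]
  apply ext_oddProj
  · rw [map_add, map_smul, oddForm_apply, oddProj_oddIncl, oddProj_qpOdd, oddProj_qpOdd]
    refine qpFun_eq hi (if_neg (lt_irrefl _)) fun j hj => ?_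
    simp only [ext0_xCoords_sigma]
    grind
  · change ext0 _ (2 * s) = ext0 _ (2 * s) + _ * 0
    rw [ext0_xCoords_sigma, if_neg (by omega : ¬ 2 * s + 1 = i)]
    simp

/-- The last generator adds the actual q_s = x_{2s-1} - x_{2s+1} to p_s, not the projected one;
hence the form is evaluated on `v ∘ Sum.inl` instead of on `oddProj s v`. -/
theorem glEquiv_rhoOdd_last (hs : 1 ≤ s) (v : (Fin s ⊕ Fin s) ⊕ Unit → ℤ) :
    glEquiv ℤ _ (rhoOdd s (PresentedGroup.of (Fin.last (2 * s)))) v =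
      v + omega ℤ s (v ∘ Sum.inl) (chainVec s (2 * s)) • oddIncl s (chainVec s (2 * s)) := by
  obtain ⟨s, rfl⟩ : ∃ s', s = s' + 1 := ⟨s - 1, by omega⟩
  rw [rhoOdd, glEquiv_rhoMatrix, rho_of]
  obtain ⟨k, rfl⟩ := ((xCoords (2 * (s + 1) + 1)).trans (qpOdd (s + 1))).surjective v
  rw [LinearEquiv.symm_apply_apply, LinearEquiv.trans_apply, LinearEquiv.trans_apply,
    show chainVec (s + 1) (2 * (s + 1)) = pVec ℤ (s + 1) s from chainVec_even (s + 1) s,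
    show pVec ℤ (s + 1) s = pVec ℤ (s + 1) (Fin.last s) from rfl, omega_pVec]
  funext i
  rcases i with (i | i) | i
  · simp [qpOdd, oddIncl_apply, pVec, ext0_xCoords_sigma]
    grind
  · simp [qpOdd, oddIncl_apply, pVec, ext0_xCoords_sigma]
    grind
  · simp [qpOdd, oddIncl_apply, pVec, ext0_xCoords_sigma]

end Odd

/-! ### The images of the braid groups -/

theorem range_le_of_generators {n : ℕ} {G : Type*} [Group G] {f : BraidGroup n →* G}
    {K : Subgroup G} (h : ∀ i, f (PresentedGroup.of i) ∈ K) : f.range ≤ K := by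
  rw [MonoidHom.range_eq_map, ← PresentedGroup.closure_range_of, MonoidHom.map_closure,
    Subgroup.closure_le]
  rintro _ ⟨_, ⟨i, rfl⟩, rfl⟩
  exact h i

section

variable {s : ℕ}

theorem range_rhoEven_le (s : ℕ) : (rhoEven s).range ≤ Sp s :=
  range_le_of_generators fun i => by
    rw [mem_Sp_iff, glEquiv_rhoEven_of]
    exact transv_mem_isometries _ _ _

theorem glEquiv_mem_map {R : Type} [CommRing R] {ι : Type} [Fintype ι] [DecidableEq ι]
    {K : Subgroup (GL ι R)} {g : GL ι R} :
    glEquiv R ι g ∈ K.map (glEquiv R ι).toMonoidHom ↔ g ∈ K :=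
  Subgroup.mem_map_iff_mem (glEquiv R ι).injective

theorem principalCongruence_Sp_le (s : ℕ) : principalCongruence (Sp s) ≤ (rhoEven s).range := by
  intro g hg
  have hc : IsChain (omega ℤ s) (chainVec s) (2 * s) :=
    ⟨omega_isAlt, fun i hi => (isChain_chainVec s).adj i (by omega),
      fun i j hi hj => (isChain_chainVec s).orth i j hi (by omega)⟩
  have htop : pairSpan (chainE (chainVec s)) (chainF (chainVec s)) 0 s = ⊤ :=
    eq_top_of_chainVec_mem _ fun i hi => IsChain.mem_pairSpan hi
  have hcong : ∀ x ∈ principalCongruence (Sp s),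
      ∀ v ∈ pairSpan (chainE (chainVec s)) (chainF (chainVec s)) 0 s,
      ∃ w ∈ pairSpan (chainE (chainVec s)) (chainF (chainVec s)) 0 s,
        glEquiv ℤ _ x v = v + (2 : ℤ) • w := by
    intro x hx v _
    obtain ⟨w, hw⟩ := (mod2_eq_one_iff x).mp hx.2 v
    exact ⟨w, by rw [htop]; trivial, hw⟩
  obtain ⟨h, hh, heq⟩ := hc.exists_eqOn
    (H := (rhoEven s).range.map (glEquiv ℤ (Fin s ⊕ Fin s)).toMonoidHom)
    (g := glEquiv ℤ _ g) (fun i hi => by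
      rw [← glEquiv_rhoEven_of ⟨i, hi⟩, glEquiv_mem_map]
      exact ⟨_, rfl⟩)
    ⟨(mem_Sp_iff g).mp hg.1, hcong g hg, by
      rw [← map_inv]
      exact hcong _ (inv_mem hg), fun i hi => by omega⟩
  rw [← glEquiv_mem_map (K := (rhoEven s).range)]
  have : h = glEquiv ℤ _ g := LinearEquiv.ext fun v => heq v (by rw [htop]; trivial)
  rwa [← this]

/-! ### Odd dimension -/

/-- On the hyperplane of last coordinate 1 this is a transvection centred at -q_s, the point where
`oddProj` vanishes; recentring at the origin produces the translation part. -/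
theorem transv_oddForm_eq (a : Fin s ⊕ Fin s → ℤ) (c : ℤ) :
    transv (oddForm s) oddForm_isAlt (oddIncl s a) c =
      affineEquiv (transv (omega ℤ s) omega_isAlt a c)
        ((c * omega ℤ s (qVec ℤ s (s - 1)) a) • a) := by
  apply LinearEquiv.ext
  intro v
  rw [transv_apply, oddForm_apply, oddProj_oddIncl, affineEquiv_apply, transv_apply, oddProj_apply,
    map_add, map_smul]
  funext i
  rcases i with i | i
  · simp [oddIncl_apply]
    ring
  · simp [oddIncl_apply]

theorem glEquiv_rhoOdd_last_eq (hs : 1 ≤ s) :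
    glEquiv ℤ _ (rhoOdd s (PresentedGroup.of (Fin.last (2 * s)))) =
      affineEquiv (transv (omega ℤ s) omega_isAlt (chainVec s (2 * s)) 1) 0 := by
  apply LinearEquiv.ext
  intro v
  rw [glEquiv_rhoOdd_last hs, affineEquiv_apply, transv_apply]
  funext i
  rcases i with i | i
  · simp [oddIncl_apply]
  · simp [oddIncl_apply]

theorem range_rhoOdd_le (hs : 1 ≤ s) : (rhoOdd s).range ≤ SpAffine s :=
  range_le_of_generators fun i => by
    rw [mem_SpAffine_iff]
    rcases Nat.lt_or_ge i (2 * s) with h | h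
    · exact ⟨_, transv_mem_isometries _ _ _, _, by rw [glEquiv_rhoOdd_of h, transv_oddForm_eq]⟩
    · obtain rfl : i = Fin.last (2 * s) := Fin.ext (by have := i.2; simp; omega)
      exact ⟨_, transv_mem_isometries _ _ _, _, glEquiv_rhoOdd_last_eq hs⟩

/-- The translations contained in a group of affine transformations. -/
def translations (H : Subgroup (((Fin s ⊕ Fin s) ⊕ Unit → ℤ) ≃ₗ[ℤ] ((Fin s ⊕ Fin s) ⊕ Unit → ℤ))) :
    AddSubgroup (Fin s ⊕ Fin s → ℤ) where
  carrier := {y | affineEquiv 1 y ∈ H}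
  add_mem' {x y} hx hy := by
    have hx' : affineEquiv 1 x ∈ H := hx
    have hy' : affineEquiv 1 y ∈ H := hy
    have := mul_mem hy' hx'
    rwa [affineEquiv_mul, one_mul] at this
  zero_mem' := by
    have : affineEquiv (1 : (Fin s ⊕ Fin s → ℤ) ≃ₗ[ℤ] (Fin s ⊕ Fin s → ℤ)) 0 = 1 := by
      apply LinearEquiv.ext
      intro v
      funext i
      rcases i with i | i <;> simp [affineEquiv_apply]
    rw [Set.mem_ofPred_eq, this]
    exact one_mem _
  neg_mem' {y} hy := by
    have : affineEquiv (1 : (Fin s ⊕ Fin s → ℤ) ≃ₗ[ℤ] (Fin s ⊕ Fin s → ℤ)) (-y) =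
        (affineEquiv 1 y)⁻¹ := by
      rw [eq_inv_iff_mul_eq_one, affineEquiv_mul]
      apply LinearEquiv.ext
      intro v
      funext i
      rcases i with i | i <;> simp [affineEquiv_apply]
    rw [Set.mem_ofPred_eq, this]
    exact inv_mem hy

variable {H : Subgroup (((Fin s ⊕ Fin s) ⊕ Unit → ℤ) ≃ₗ[ℤ] ((Fin s ⊕ Fin s) ⊕ Unit → ℤ))}

theorem mem_translations {y : Fin s ⊕ Fin s → ℤ} : y ∈ translations H ↔ affineEquiv 1 y ∈ H :=
  Iff.rfl

theorem apply_mem_translations {T : (Fin s ⊕ Fin s → ℤ) ≃ₗ[ℤ] (Fin s ⊕ Fin s → ℤ)}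
    {z y : Fin s ⊕ Fin s → ℤ} (hT : affineEquiv T z ∈ H) (hy : y ∈ translations H) :
    T y ∈ translations H := by
  have h : affineEquiv 1 (T y) * affineEquiv T z = affineEquiv T z * affineEquiv 1 y := by
    rw [affineEquiv_mul, affineEquiv_mul, one_mul, mul_one, add_comm]
    rfl
  rw [mem_translations, eq_mul_inv_of_mul_eq h]
  exact mul_mem (mul_mem hT hy) (inv_mem hT)

/-- Since a_{2s} = -E_{s-1}, the first 2s generators yield a squared transvection along a_{2s}
centred at -q_s, while the last generator yields one centred at the origin. Their quotient is a
translation by 2a_{2s} up to sign, as ω(q_s, a_{2s}) = 1. Descending the chain then gives all 2a_i.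
-/
theorem two_smul_mem_translations (hs : 1 ≤ s)
    (hH : ∀ i < 2 * s, transv (oddForm s) oddForm_isAlt (oddIncl s (chainVec s i)) 1 ∈ H)
    (hlast : affineEquiv (transv (omega ℤ s) omega_isAlt (chainVec s (2 * s)) 1) 0 ∈ H)
    (y : Fin s ⊕ Fin s → ℤ) : (2 : ℤ) • y ∈ translations H := by
  have hch := isChain_chainVec s
  -- Translations are normalized by the group, so the difference between a translation vector and
  -- its image under a transvection is again one.
  have hstep : ∀ i < 2 * s, ∀ y ∈ translations H,
      omega ℤ s y (chainVec s i) • chainVec s i ∈ translations H := by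
    intro i hi y hy
    have h1 := hH i hi
    rw [transv_oddForm_eq] at h1
    have h2 := sub_mem (apply_mem_translations h1 hy) hy
    rwa [transv_apply, one_mul, add_sub_cancel_left] at h2
  have h0 : (2 : ℤ) • chainVec s (2 * s) ∈ translations H := by
    have h1 := (isChain_oddIncl s).transv_chainE_mem hH (i := s - 1) (by omega)
    have h2 : chainE (fun i => oddIncl s (chainVec s i)) (s - 1) =
        -oddIncl s (chainVec s (2 * s)) := by
      rw [chainVec_last hs, map_neg, neg_neg, chainE, chainE, map_sum]
    rw [h2, transv_neg, transv_oddForm_eq] at h1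
    have h3 : omega ℤ s (qVec ℤ s (s - 1)) (chainVec s (2 * s)) = 1 := by
      obtain ⟨t, rfl⟩ : ∃ t, s = t + 1 := ⟨s - 1, by omega⟩
      rw [show chainVec (t + 1) (2 * (t + 1)) = pVec ℤ (t + 1) t from chainVec_even (t + 1) t,
        isHyperbolic_qVec_pVec.ef _ (by omega) _ (by omega), if_pos (by omega)]
    rw [h3, mul_one] at h1
    have h4 := mul_mem hlast hlast
    rw [affineEquiv_mul, transv_mul, map_zero, add_zero, one_add_one_eq_two] at h4
    have h5 := mul_mem h4 (inv_mem h1)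
    rw [← neg_mem_iff, mem_translations]
    convert h5 using 1
    rw [eq_mul_inv_iff_mul_eq, affineEquiv_mul, one_mul]
    congr 1
    exact add_neg_cancel _
  have h1 : ∀ d, d ≤ 2 * s → (2 : ℤ) • chainVec s (2 * s - d) ∈ translations H := by
    intro d
    induction d with
    | zero => exact fun _ => h0
    | succ d ih =>
      intro hd
      have h2 := hstep (2 * s - (d + 1)) (by omega) _ (ih (by omega))
      have h3 := hch.apply_eq (i := 2 * s - d) (j := 2 * s - (d + 1)) (by omega) (by omega)
      rw [if_neg (by omega), if_pos (by omega)] at h3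
      rw [map_smul, LinearMap.smul_apply, h3, smul_eq_mul, mul_neg, mul_one, neg_smul,
        neg_mem_iff] at h2
      exact h2
  have h2 : (translations H).comap (zsmulAddGroupHom (2 : ℤ)) = ⊤ :=
    eq_top_of_chainVec_mem _ fun i hi => by
      have := h1 (2 * s - i) (by omega)
      rwa [show 2 * s - (2 * s - i) = i by omega] at this
  have h3 : y ∈ (translations H).comap (zsmulAddGroupHom (2 : ℤ)) := by rw [h2]; trivial
  exact h3

/-- An affine map fixing P is determined by its linear part. So `g` is first corrected by an even
translation to fix P, and the chain argument is run inside the stabilizer of P. -/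
theorem principalCongruence_SpAffine_le (hs : 1 ≤ s) :
    principalCongruence (SpAffine s) ≤ (rhoOdd s).range := by
  intro g hg
  set H := (rhoOdd s).range.map (glEquiv ℤ ((Fin s ⊕ Fin s) ⊕ Unit)).toMonoidHom with hHdef
  have hH : ∀ i < 2 * s, transv (oddForm s) oddForm_isAlt (oddIncl s (chainVec s i)) 1 ∈ H := by
    intro i hi
    have := glEquiv_rhoOdd_of (s := s) (i := ⟨i, by omega⟩) hi
    rw [← this, glEquiv_mem_map]
    exact ⟨_, rfl⟩
  have hlast : affineEquiv (transv (omega ℤ s) omega_isAlt (chainVec s (2 * s)) 1) 0 ∈ H := by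
    rw [← glEquiv_rhoOdd_last_eq hs, glEquiv_mem_map]
    exact ⟨_, rfl⟩
  have htr := two_smul_mem_translations hs hH hlast
  have hc := isChain_oddIncl s
  set a := fun i => oddIncl s (chainVec s i) with ha
  -- the vector fixed by all generators but the last
  set P : (Fin s ⊕ Fin s) ⊕ Unit → ℤ := Sum.elim (-qVec ℤ s (s - 1)) 1 with hP
  have hPproj : oddProj s P = 0 := by simp [oddProj_apply, hP]
  have hspan : ∀ y, oddIncl s y ∈ pairSpan (chainE a) (chainF a) 0 s := by
    have : (pairSpan (chainE a) (chainF a) 0 s).comap (oddIncl s).toAddMonoidHom = ⊤ :=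
      eq_top_of_chainVec_mem _ fun i hi => IsChain.mem_pairSpan (a := a) hi
    intro y
    have h : y ∈ (pairSpan (chainE a) (chainF a) 0 s).comap (oddIncl s).toAddMonoidHom := by
      rw [this]; trivial
    exact h
  have hincl : ∀ v w : (Fin s ⊕ Fin s) ⊕ Unit → ℤ,
      (v + (2 : ℤ) • w) (Sum.inr ()) = v (Sum.inr ()) → w = oddIncl s (w ∘ Sum.inl) := by
    intro v w h
    have h0 : w (Sum.inr ()) = 0 := by simpa using h
    funext i
    rcases i with i | i
    · rfl
    · exact h0
  have hcong : ∀ x ∈ principalCongruence (SpAffine s), ∀ v,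
      ∃ w, glEquiv ℤ _ x v = v + (2 : ℤ) • oddIncl s w := by
    intro x hx v
    obtain ⟨w, hw⟩ := (mod2_eq_one_iff x).mp hx.2 v
    obtain ⟨T, -, y, hT⟩ := (mem_SpAffine_iff x).mp hx.1
    refine ⟨_, by rw [hw, ← hincl v w]; rw [← hw, hT]; rfl⟩
  -- `g` moves P by 2u, so the translation by -2u restores it.
  obtain ⟨u, hu⟩ := hcong g hg P
  have hτ : (glEquiv ℤ _).symm (affineEquiv 1 ((2 : ℤ) • -u)) ∈ principalCongruence (SpAffine s) := by
    refine ⟨(mem_SpAffine_iff _).mpr ⟨1, one_mem _, _, by rw [MulEquiv.apply_symm_apply]⟩,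
      (mod2_eq_one_iff _).mpr fun v => ⟨oddIncl s (v (Sum.inr ()) • -u), ?_⟩⟩
    rw [MulEquiv.apply_symm_apply, affineEquiv_apply]
    funext i
    rcases i with i | i
    · simp [oddIncl_apply]
      ring
    · simp [oddIncl_apply]
  have hg' := mul_mem hτ hg
  set g' := (glEquiv ℤ _).symm (affineEquiv 1 ((2 : ℤ) • -u)) * g with hg'def
  have hg'eq : glEquiv ℤ _ g' = affineEquiv 1 ((2 : ℤ) • -u) * glEquiv ℤ _ g := by
    rw [hg'def, map_mul, MulEquiv.apply_symm_apply]
  have hg'P : glEquiv ℤ _ g' P = P := by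
    rw [hg'eq, LinearEquiv.mul_apply, hu, affineEquiv_apply]
    funext i
    rcases i with i | i <;> simp [oddIncl_apply, hP]
  have hdec : ∀ v, v = oddIncl s (oddProj s v) + v (Sum.inr ()) • P := by
    intro v
    funext i
    rcases i with i | i <;> simp [oddProj_apply, oddIncl_apply, hP]
  obtain ⟨T, hT, y, hTy⟩ := (mem_SpAffine_iff g').mp hg'.1
  have hproj : ∀ v, oddProj s (glEquiv ℤ _ g' v) = T (oddProj s v) := by
    intro v
    conv_lhs => rw [hdec v, map_add, map_smul, hg'P, map_add, map_smul, hPproj, smul_zero, add_zero]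
    rw [hTy, affineEquiv_apply, oddProj_apply]
    simp [oddIncl_apply]
  -- Intersecting with the stabilizer makes `h` fix P too; agreement on the hyperplane and at P then
  -- gives equality by `hdec`.
  obtain ⟨h, hh, heq⟩ := hc.exists_eqOn
    (H := H ⊓ MulAction.stabilizer _ P) (g := glEquiv ℤ _ g') (fun i hi => ⟨hH i hi, by
      change transv (oddForm s) oddForm_isAlt _ 1 P = P
      rw [transv_apply, oddForm_apply, hPproj]
      simp⟩)
    ⟨fun v w => by rw [oddForm_apply, hproj, hproj, hT]; rfl,
      fun v _ => by
        obtain ⟨w, hw⟩ := hcong g' hg' v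
        exact ⟨_, hspan w, hw⟩,
      fun v _ => by
        obtain ⟨w, hw⟩ := hcong _ (inv_mem hg') v
        rw [← map_inv]
        exact ⟨_, hspan w, hw⟩, fun i hi => by omega⟩
  have hheq : h = glEquiv ℤ _ g' := by
    apply LinearEquiv.ext
    intro v
    rw [hdec v, map_add, map_add, heq _ (hspan _), map_smul, map_smul, hg'P,
      show h P = P from hh.2]
  rw [← glEquiv_mem_map (K := (rhoOdd s).range)]
  have h1 : affineEquiv 1 ((2 : ℤ) • -u) ∈ H := htr (-u)
  have h2 := mul_mem (inv_mem h1) (hheq ▸ hh.1)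
  rwa [hg'eq, inv_mul_cancel_left] at h2

/-! ### Indices -/

/-- Since `G` contains the kernel of reduction on `A`, reduction modulo 2 preserves its index. -/
theorem card_map_mul_relIndex {ι : Type} [Fintype ι] [DecidableEq ι] {G A : Subgroup (GL ι ℤ)}
    (hGA : G ≤ A) (hA : principalCongruence A ≤ G) :
    Nat.card (G.map (mod2 ι)) * G.relIndex A = Nat.card (A.map (mod2 ι)) := by
  have h1 := Subgroup.relIndex_mul_relIndex _ _ _ hA hGA
  have h2 : principalCongruence A ⊓ G = (mod2 ι).ker ⊓ G := by
    rw [principalCongruence, inf_comm A, inf_assoc, inf_eq_right.mpr hGA]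
  rw [← Subgroup.inf_relIndex_right (principalCongruence A) G, h2, Subgroup.inf_relIndex_right,
    principalCongruence, inf_comm A, Subgroup.inf_relIndex_right, Subgroup.relIndex_ker,
    Subgroup.relIndex_ker] at h1
  exact h1

theorem card_map_range_rhoMatrix {n : ℕ} (hn : 2 ≤ n) {ι : Type} [Fintype ι] [DecidableEq ι]
    (c : (Fin n → ℤ) ≃ₗ[ℤ] (ι → ℤ)) :
    Nat.card ((rhoMatrix c).range.map (mod2 ι)) = Nat.factorial (n + 1) := by
  obtain ⟨e, -⟩ := exists_mulEquiv_of_ker_eq ((mod2 ι).comp (rhoMatrix c)) (braidPerm n)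
    (braidPerm_surjective n) (mod2_rhoMatrix_eq_one_iff_braidPerm hn c)
  rw [MonoidHom.map_range, Nat.card_congr e.toEquiv, Nat.card_perm, Nat.card_fin]

/-- The reduction modulo 2 of the symplectic group, as a group of linear automorphisms. -/
def spMod2 (s : ℕ) : Subgroup ((Fin s ⊕ Fin s → ZMod 2) ≃ₗ[ZMod 2] (Fin s ⊕ Fin s → ZMod 2)) :=
  ((Sp s).map (mod2 _)).map (glEquiv (ZMod 2) _).toMonoidHom

theorem mem_spMod2_iff {T : (Fin s ⊕ Fin s → ZMod 2) ≃ₗ[ZMod 2] (Fin s ⊕ Fin s → ZMod 2)} :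
    T ∈ spMod2 s ↔ ∃ T' ∈ isometries (omega ℤ s), ∀ v i,
      T (fun j => (v j : ZMod 2)) i = (T' v i : ZMod 2) := by
  constructor
  · rintro ⟨_, ⟨A, hA, rfl⟩, rfl⟩
    exact ⟨_, (mem_Sp_iff A).mp hA, fun v i => glEquiv_mod2_apply A v i⟩
  · rintro ⟨T', hT', h⟩
    refine ⟨_, ⟨(glEquiv ℤ _).symm T', (mem_Sp_iff _).mpr (by rwa [MulEquiv.apply_symm_apply]), rfl⟩,
      ?_⟩
    apply LinearEquiv.ext
    intro v
    obtain ⟨w, rfl⟩ := exists_lift_zmod2 v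
    funext i
    rw [h]
    refine (glEquiv_mod2_apply _ w i).trans ?_
    rw [MulEquiv.apply_symm_apply]

theorem omega_zmod2 (v w : Fin s ⊕ Fin s → ℤ) :
    omega (ZMod 2) s (fun i => (v i : ZMod 2)) (fun i => (w i : ZMod 2)) =
      (omega ℤ s v w : ZMod 2) := by
  simp [omega_apply]

/-- Every transvection over the field with two elements lifts to an integral one, so the reduction
contains them all and the orbit count applies. -/
theorem card_map_Sp (s : ℕ) : Nat.card ((Sp s).map (mod2 _)) =
    ∏ k ∈ Finset.Icc 1 s, ((2 ^ (2 * k) - 1) * 2 ^ (2 * k - 1)) := by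
  rw [Nat.card_congr (((Sp s).map (mod2 _)).equivMapOfInjective
    (glEquiv (ZMod 2) (Fin s ⊕ Fin s)).toMonoidHom (glEquiv (ZMod 2) _).injective).toEquiv]
  refine isHyperbolic_qVec_pVec.card_eq_prod (Γ := spMod2 s) ?_ ?_ ?_
  · intro v hv
    funext i
    rcases i with i | i
    · simpa [omega_pVec] using (hv i i.2).2
    · simpa [omega_qVec] using (hv i i.2).1
  · intro T hT x y
    obtain ⟨T', hT', h⟩ := mem_spMod2_iff.mp hT
    obtain ⟨v, rfl⟩ := exists_lift_zmod2 x
    obtain ⟨w, rfl⟩ := exists_lift_zmod2 y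
    rw [funext (h v), funext (h w), omega_zmod2, omega_zmod2, hT']
  · intro u
    obtain ⟨u, rfl⟩ := exists_lift_zmod2 u
    refine mem_spMod2_iff.mpr ⟨_, transv_mem_isometries omega_isAlt u 1, fun v i => ?_⟩
    simp [transv_apply, omega_zmod2]

theorem card_map_SpAffine (s : ℕ) : Nat.card ((SpAffine s).map (mod2 _)) =
    2 ^ (2 * s) * Nat.card ((Sp s).map (mod2 _)) := by
  have h1 : Nat.card ((Sp s).map (mod2 _)) = Nat.card (spMod2 s) :=
    Nat.card_congr (((Sp s).map (mod2 _)).equivMapOfInjective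
      (glEquiv (ZMod 2) (Fin s ⊕ Fin s)).toMonoidHom (glEquiv (ZMod 2) _).injective).toEquiv
  have h2 : ((((SpAffine s).map (mod2 _)).map
      (glEquiv (ZMod 2) ((Fin s ⊕ Fin s) ⊕ Unit)).toMonoidHom : Subgroup _) : Set _) =
      (fun p : _ × _ => affineEquiv p.1 p.2) ''
        ((spMod2 s : Set _) ×ˢ (Set.univ : Set (Fin s ⊕ Fin s → ZMod 2))) := by
    have key : ∀ (T : (Fin s ⊕ Fin s → ZMod 2) ≃ₗ[ZMod 2] (Fin s ⊕ Fin s → ZMod 2))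
        (T' : (Fin s ⊕ Fin s → ℤ) ≃ₗ[ℤ] (Fin s ⊕ Fin s → ℤ)) (y : Fin s ⊕ Fin s → ℤ)
        (A : GL ((Fin s ⊕ Fin s) ⊕ Unit) ℤ), glEquiv ℤ _ A = affineEquiv T' y →
        (∀ v i, T (fun j => (v j : ZMod 2)) i = (T' v i : ZMod 2)) →
        affineEquiv T (fun i => (y i : ZMod 2)) = glEquiv (ZMod 2) _ (mod2 _ A) := by
      intro T T' y A hA h
      apply LinearEquiv.ext
      intro v
      obtain ⟨v, rfl⟩ := exists_lift_zmod2 v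
      funext i
      rw [glEquiv_mod2_apply, hA, affineEquiv_apply, affineEquiv_apply]
      rcases i with i | i
      · simp [← h, Function.comp_def]
      · simp
    ext B
    constructor
    · rintro ⟨_, ⟨A, hA, rfl⟩, rfl⟩
      obtain ⟨T', hT', y, h⟩ := (mem_SpAffine_iff A).mp hA
      refine ⟨(glEquiv (ZMod 2) _ (mod2 _ ((glEquiv ℤ _).symm T')), fun i => (y i : ZMod 2)),
        ⟨⟨_, ⟨_, (mem_Sp_iff _).mpr (by rwa [MulEquiv.apply_symm_apply]), rfl⟩, rfl⟩, trivial⟩,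
        key _ T' y A h fun v i => ?_⟩
      rw [glEquiv_mod2_apply, MulEquiv.apply_symm_apply]
    · rintro ⟨⟨T, y⟩, ⟨hT, -⟩, rfl⟩
      obtain ⟨T', hT', h⟩ := mem_spMod2_iff.mp hT
      obtain ⟨y, rfl⟩ := exists_lift_zmod2 y
      have hA : glEquiv ℤ ((Fin s ⊕ Fin s) ⊕ Unit) ((glEquiv ℤ _).symm (affineEquiv T' y)) =
        affineEquiv T' y := MulEquiv.apply_symm_apply _ _
      exact ⟨_, ⟨_, (mem_SpAffine_iff _).mpr ⟨T', hT', y, hA⟩, rfl⟩, (key T T' y _ hA h).symm⟩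
  rw [h1, Nat.card_congr (((SpAffine s).map (mod2 _)).equivMapOfInjective
      (glEquiv (ZMod 2) ((Fin s ⊕ Fin s) ⊕ Unit)).toMonoidHom (glEquiv (ZMod 2) _).injective).toEquiv]
  rw [← SetLike.coe_sort_coe, Nat.card_coe_set_eq, h2, Set.InjOn.ncard_image, Set.ncard_prod,
    Set.ncard_univ, ← Nat.card_coe_set_eq, SetLike.coe_sort_coe, mul_comm]
  · congr 1
    simp [two_mul]
  · rintro ⟨T, y⟩ - ⟨T', y'⟩ - h
    obtain ⟨rfl, rfl⟩ := affineEquiv_injective h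
    rfl

/-- The exponents 2k - 1 sum to s². -/
theorem cast_prod_eq (s : ℕ) :
    ((∏ k ∈ Finset.Icc 1 s, ((2 ^ (2 * k) - 1) * 2 ^ (2 * k - 1)) : ℕ) : ℚ) =
      2 ^ (s ^ 2) * ∏ k ∈ Finset.Icc 1 s, ((2 : ℚ) ^ (2 * k) - 1) := by
  induction s with
  | zero => simp
  | succ s ih =>
    rw [Finset.prod_Icc_succ_top (by omega), Finset.prod_Icc_succ_top (by omega), Nat.cast_mul, ih,
      Nat.cast_mul, Nat.cast_sub Nat.one_le_two_pow, show 2 * (s + 1) - 1 = 2 * s + 1 by omega]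
    push_cast
    ring

end

end BraidSymplectic

/-! ### The theorem for both parities. -/

open BraidSymplectic in
theorem mainTheorem4 (s : ℕ) (hs : 1 ≤ s) :
    -- the case of even dimension `n = 2s`
    ((rhoEven s).range ≤ Sp s ∧
      (∃ e : ((mod2 (Fin s ⊕ Fin s)).comp (rhoEven s)).range ≃* Equiv.Perm (Fin (2 * s + 1)),
        ∀ i : Fin (2 * s),
          e ⟨mod2 (Fin s ⊕ Fin s) (rhoEven s (PresentedGroup.of i)), ⟨PresentedGroup.of i, rfl⟩⟩
            = Equiv.swap i.castSucc i.succ) ∧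
      principalCongruence (Sp s) ≤ (rhoEven s).range ∧
      ((rhoEven s).range.relIndex (Sp s) : ℚ) =
        2 ^ (s ^ 2) * (∏ k ∈ Finset.Icc 1 s, ((2 : ℚ) ^ (2 * k) - 1)) /
          (Nat.factorial (2 * s + 1) : ℚ)) ∧
    -- the case of odd dimension `n = 2s + 1`
    ((rhoOdd s).range ≤ SpAffine s ∧
      (∃ e : ((mod2 ((Fin s ⊕ Fin s) ⊕ Unit)).comp (rhoOdd s)).range ≃*
          Equiv.Perm (Fin (2 * s + 2)),
        ∀ i : Fin (2 * s + 1),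
          e ⟨mod2 ((Fin s ⊕ Fin s) ⊕ Unit) (rhoOdd s (PresentedGroup.of i)),
              ⟨PresentedGroup.of i, rfl⟩⟩
            = Equiv.swap i.castSucc i.succ) ∧
      principalCongruence (SpAffine s) ≤ (rhoOdd s).range ∧
      ((rhoOdd s).range.relIndex (SpAffine s) : ℚ) =
        2 ^ (s ^ 2 + 2 * s) * (∏ k ∈ Finset.Icc 1 s, ((2 : ℚ) ^ (2 * k) - 1)) /
          (Nat.factorial (2 * s + 2) : ℚ)) := by
  refine ⟨⟨range_rhoEven_le s, ?_, principalCongruence_Sp_le s, ?_⟩,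
    range_rhoOdd_le hs, ?_, principalCongruence_SpAffine_le hs, ?_⟩
  · obtain ⟨e, he⟩ := exists_mulEquiv_of_ker_eq ((mod2 _).comp (rhoEven s)) (braidPerm (2 * s))
      (braidPerm_surjective _) (mod2_rhoMatrix_eq_one_iff_braidPerm (by omega) _)
    exact ⟨e, fun i => (he _).trans (braidPerm_of i)⟩
  · have h := card_map_mul_relIndex (range_rhoEven_le s) (principalCongruence_Sp_le s)
    rw [card_map_Sp, rhoEven, card_map_range_rhoMatrix (by omega)] at h
    rw [eq_div_iff (by positivity), ← cast_prod_eq, ← h, mul_comm, Nat.cast_mul]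
    rfl
  · obtain ⟨e, he⟩ := exists_mulEquiv_of_ker_eq ((mod2 _).comp (rhoOdd s)) (braidPerm (2 * s + 1))
      (braidPerm_surjective _) (mod2_rhoMatrix_eq_one_iff_braidPerm (by omega) _)
    exact ⟨e, fun i => (he _).trans (braidPerm_of i)⟩
  · have h := card_map_mul_relIndex (range_rhoOdd_le hs) (principalCongruence_SpAffine_le hs)
    rw [card_map_SpAffine, card_map_Sp, rhoOdd, card_map_range_rhoMatrix (by omega)] at h
    have h' := congrArg (Nat.cast : ℕ → ℚ) h
    rw [Nat.cast_mul, Nat.cast_mul, cast_prod_eq] at h'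
    rw [eq_div_iff (by positivity), pow_add, mul_comm]
    refine h'.trans ?_
    push_cast
    ring
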